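/- Let $n \in \mathbb{N}$, $s \in (0,1)$ and $p \in [1,\infty)$ with $sp < n$, and let $q$ be given by $\frac1q = \frac1p - \frac sn$ (so $1<q<\infty$). Notation. $\mathcal{S}(\mathbb{R}^n)$ is the space of complex-valued Schwartz functions and $\mathcal{S}'(\mathbb{R}^n)$ its dual. $\mathcal{S}_{od}(\mathbb{R}^{2n})$ is the space of $G \in \mathcal{S}(\mathbb{R}^n\times\mathbb{R}^n)$ with $G(x,y) = -G(y,x)$ and $\partial_x^\alpha\partial_y^\beta G(z,z)=0$ for all multi-indices $\alpha,\beta$ and all $z\in\mathbb{R}^n$, with the subspace topology. For such $G$ the fractional divergence $$\operatorname{div}_s G(x) := \int_{\mathbb{R}^n} \frac{2G(x,y)}{|x-y|^s}\,\frac{dy}{|x-y|^n}$$ belongs to $\mathcal{S}(\mathbb{R}^n)$ and depends continuously on $G$. The fractional gradient of $u \in \mathcal{S}'(\mathbb{R}^n)$ is the continuous linear functional $d_s u$ on $\mathcal{S}_{od}(\mathbb{R}^{2n})$ given by $\langle d_s u, G\rangle := \langle u, \operatorname{div}_s G\rangle$. $L^p_{od}(\mathbb{R}^{2n})$ is the space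 of measurable $F:\mathbb{R}^n\times\mathbb{R}^n\to\mathbb{C}$ with $F(x,y)=-F(y,x)$ almost everywhere and $$\|F\|_{L^p_{od}} := \Big(\int_{\mathbb{R}^n}\int_{\mathbb{R}^n} |F(x,y)|^p \,\frac{dx\,dy}{|x-y|^n}\Big)^{1/p} < \infty .$$ We say that $d_s u \in L^p_{od}(\mathbb{R}^{2n})$ if there is $F \in L^p_{od}(\mathbb{R}^{2n})$ with $\langle d_s u, G\rangle = \iint F(x,y)\,G(x,y)\,\frac{dx\,dy}{|x-y|^n}$ for all $G\in\mathcal{S}_{od}(\mathbb{R}^{2n})$, and then $\|d_s u\|_{L^p_{od}} := \|F\|_{L^p_{od}}$. Theorem. There is a constant $K>0$, depending only on $n$, $s$, $p$, such that for every $u\in\mathcal{S}'(\mathbb{R}^n)$ with $d_s u\in L^p_{od}(\mathbb{R}^{2n})$ there is a constant $C_u\in\mathbb{C}$ for which the distribution $u-C_u$ is given by a function in $L^q(\mathbb{R}^n)$ and $$\|u-C_u\|_{L^q(\mathbb{R}^n)} \le K\,\|d_s u\|_{L^p_{od}} .$$ If $u$ is real (that is, $\langle u,\varphi\rangle\in\mathbb{R}$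 for every real-valued $\varphi\in\mathcal{S}(\mathbb{R}^n)$), then $C_u\in\mathbb{R}$. -/

import Mathlib

open MeasureTheory SchwartzMap
open scoped ENNReal ContDiff

noncomputable section

namespace FracGrad

/-- Euclidean space `ℝⁿ`. The space `ℝ²ⁿ` is represented as `Rn n × Rn n`. -/
abbrev Rn (n : ℕ) := EuclideanSpace ℝ (Fin n)

/-! ### Off-diagonal Schwartz functions -/

/-- Off-diagonal Schwartz functions: antisymmetric Schwartz functions on `ℝⁿ × ℝⁿ` all of whose
derivatives, of every order, vanish on the diagonal. (The iterated Fréchet derivative of order `k`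
collects all the partial derivatives of order `k`.) It carries the subspace topology. -/
def offDiagSchwartz (n : ℕ) : Submodule ℂ 𝓢(Rn n × Rn n, ℂ) where
  carrier := {G | (∀ x y, G (x, y) = -G (y, x)) ∧
    ∀ (k : ℕ) (z : Rn n), iteratedFDeriv ℝ k G (z, z) = 0}
  zero_mem' := by
    refine ⟨fun x y => by simp, fun k z => ?_⟩
    have : ((0 : 𝓢(Rn n × Rn n, ℂ)) : Rn n × Rn n → ℂ) = fun _ => 0 := by ext; simp
    rw [this, iteratedFDeriv_fun_zero]
    rfl
  add_mem' := by
    rintro F G ⟨hF, hF'⟩ ⟨hG, hG'⟩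
    refine ⟨fun x y => ?_, fun k z => ?_⟩
    · rw [add_apply, add_apply, hF x y, hG x y]; ring
    · have : ((F + G : 𝓢(Rn n × Rn n, ℂ)) : Rn n × Rn n → ℂ) = ⇑F + ⇑G := by ext; simp
      rw [this, iteratedFDeriv_add_apply (F.smooth k).contDiffAt (G.smooth k).contDiffAt,
        hF', hG', add_zero]
  smul_mem' := by
    rintro c F ⟨hF, hF'⟩
    refine ⟨fun x y => ?_, fun k z => ?_⟩
    · rw [smul_apply, smul_apply, hF x y, smul_neg]
    · have : ((c • F : 𝓢(Rn n × Rn n, ℂ)) : Rn n × Rn n → ℂ) = c • ⇑F := by ext; simp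
      rw [this, iteratedFDeriv_const_smul_apply (F.smooth k).contDiffAt, hF', smul_zero]

/-! ### The fractional divergence

`div_s G (x) = ∫ 2 G(x,y) / |x-y|^s dy / |x-y|^n`. The lemmas below show that it is a Schwartz
function of `x`, depending continuously on `G`. -/

/-- The fractional divergence of `G`, as a function on `ℝⁿ`. -/
def fracDivFun {n : ℕ} (s : ℝ) (G : Rn n × Rn n → ℂ) (x : Rn n) : ℂ :=
  ∫ y, ‖x - y‖ ^ (-(n + s)) • (2 * G (x, y))

section Aux

variable {n : ℕ}

theorem slice_iter (H : 𝓢(Rn n × Rn n, ℂ)) (j : ℕ) (x z : Rn n) :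
    iteratedFDeriv ℝ j (fun x => H (x, z)) x =
      (iteratedFDeriv ℝ j H (x, z)).compContinuousLinearMap
        (fun _ => ContinuousLinearMap.inl ℝ (Rn n) (Rn n)) := by
  have h1 : (fun x => H (x, z)) =
      (fun w => H (w + (0, z))) ∘ (ContinuousLinearMap.inl ℝ (Rn n) (Rn n)) := by
    ext x; simp
  have hs : ContDiff ℝ j (fun w => H (w + (0, z))) :=
    (H.smooth j).comp (contDiff_id.add contDiff_const)
  rw [h1, ContinuousLinearMap.iteratedFDeriv_comp_right _ hs x le_rfl,
    iteratedFDeriv_comp_add_right]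
  simp

theorem norm_slice_iter_le (H : 𝓢(Rn n × Rn n, ℂ)) (j : ℕ) (x z : Rn n) :
    ‖iteratedFDeriv ℝ j (fun x => H (x, z)) x‖ ≤ ‖iteratedFDeriv ℝ j H (x, z)‖ := by
  rw [slice_iter]
  refine (ContinuousMultilinearMap.norm_compContinuousLinearMap_le _ _).trans ?_
  refine mul_le_of_le_one_right (norm_nonneg _) ?_
  exact Finset.prod_le_one (fun _ _ => norm_nonneg _)
    (fun _ _ => ContinuousLinearMap.norm_inl_le_one ℝ (Rn n) (Rn n))

/-- Functions that are flat on `z = 0` vanish there to any order, with decay in `x`. -/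
theorem flat_bound (H : 𝓢(Rn n × Rn n, ℂ))
    (hH : ∀ (k : ℕ) (x : Rn n), iteratedFDeriv ℝ k H (x, 0) = 0) (k m : ℕ) :
    ∀ (j : ℕ) (x z : Rn n), ‖x‖ ^ k * ‖iteratedFDeriv ℝ j H (x, z)‖ ≤
      ‖z‖ ^ m * SchwartzMap.seminorm ℂ k (j + m) H := by
  induction m with
  | zero =>
    intro j x z
    rw [pow_zero, one_mul, add_zero]
    refine le_trans ?_ (SchwartzMap.le_seminorm ℂ k j H (x, z))
    gcongr
    exact norm_fst_le (x, z)
  | succ m ih =>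
    intro j x z
    set S := SchwartzMap.seminorm ℂ k (j + (m + 1)) H with hS
    have hS0 : 0 ≤ S := apply_nonneg _ _
    rcases eq_or_ne (‖x‖ ^ k) 0 with h0 | h0
    · rw [h0, zero_mul]; positivity
    have hpos : 0 < ‖x‖ ^ k := lt_of_le_of_ne (by positivity) (Ne.symm h0)
    have hd : Differentiable ℝ (iteratedFDeriv ℝ j H) :=
      (H.smooth (j + 1)).differentiable_iteratedFDeriv (by exact_mod_cast Nat.lt_succ_self j)
    have key : ‖iteratedFDeriv ℝ j H (x, z) - iteratedFDeriv ℝ j H (x, 0)‖ ≤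
        (‖z‖ ^ m * S / ‖x‖ ^ k) * ‖((x, z) : Rn n × Rn n) - (x, 0)‖ := by
      refine (convex_segment ((x, 0) : Rn n × Rn n) (x, z)).norm_image_sub_le_of_norm_fderiv_le
        (𝕜 := ℝ) (fun w _ => hd w) ?_ (left_mem_segment _ _ _) (right_mem_segment _ _ _)
      rintro w ⟨a, b, ha, hb, hab, rfl⟩
      have hw : a • ((x, 0) : Rn n × Rn n) + b • (x, z) = (x, b • z) := by
        simp [← add_smul, hab]
      rw [hw, norm_fderiv_iteratedFDeriv, le_div_iff₀ hpos, mul_comm]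
      refine (ih (j + 1) x (b • z)).trans ?_
      have e : j + 1 + m = j + (m + 1) := by ring
      rw [e]
      gcongr
      rw [norm_smul, Real.norm_of_nonneg hb]
      exact mul_le_of_le_one_left (norm_nonneg _) (by linarith)
    rw [hH, sub_zero] at key
    have : ‖((x, z) : Rn n × Rn n) - (x, 0)‖ = ‖z‖ := by simp
    rw [this] at key
    calc ‖x‖ ^ k * ‖iteratedFDeriv ℝ j H (x, z)‖
        ≤ ‖x‖ ^ k * ((‖z‖ ^ m * S / ‖x‖ ^ k) * ‖z‖) := by gcongr
      _ = ‖z‖ ^ (m + 1) * S := by field_simp; ring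

/-- The order of vanishing which is used against the kernel `|z|^(-(n+s))`. -/
def ord (n : ℕ) (s : ℝ) : ℕ := ⌈|(n : ℝ) + s|⌉₊

/-- The seminorm which controls the integrand. -/
def ctrl (n : ℕ) (s : ℝ) (k j : ℕ) : Seminorm ℂ 𝓢(Rn n × Rn n, ℂ) :=
  SchwartzMap.seminorm ℂ k (j + ord n s) +
    SchwartzMap.seminorm ℂ (k + ord n s + (n + 1)) j

theorem kernel_bound (s : ℝ) (H : 𝓢(Rn n × Rn n, ℂ))
    (hH : ∀ (k : ℕ) (x : Rn n), iteratedFDeriv ℝ k H (x, 0) = 0) (k j : ℕ) (x z : Rn n) :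
    ‖x‖ ^ k * (‖z‖ ^ (-(n + s)) * ‖iteratedFDeriv ℝ j H (x, z)‖) ≤
      2 ^ (n + 1) * ctrl n s k j H * (1 + ‖z‖) ^ (-((n : ℝ) + 1)) := by
  set m := ord n s with hm
  have hms : |(n : ℝ) + s| ≤ m := Nat.le_ceil _
  set A := SchwartzMap.seminorm ℂ k (j + m) H with hA
  set B := SchwartzMap.seminorm ℂ (k + m + (n + 1)) j H with hB
  have hA0 : 0 ≤ A := apply_nonneg _ _
  have hB0 : 0 ≤ B := apply_nonneg _ _
  have hctrl : ctrl n s k j H = A + B := rfl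
  have hz1 : 0 < 1 + ‖z‖ := by positivity
  have hrp : (1 + ‖z‖) ^ (-((n : ℝ) + 1)) = ((1 + ‖z‖) ^ (n + 1))⁻¹ := by
    rw [Real.rpow_neg hz1.le, ← Real.rpow_natCast]; push_cast; rfl
  rw [hctrl, hrp, ← div_eq_mul_inv, le_div_iff₀ (by positivity)]
  rcases eq_or_ne z 0 with rfl | hz
  · rw [hH]; simp; positivity
  have hzp : 0 < ‖z‖ := norm_pos_iff.2 hz
  rcases le_total ‖z‖ 1 with h | h
  · have h1 : ‖z‖ ^ (-(n + s)) * ‖z‖ ^ m ≤ 1 := by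
      rw [← Real.rpow_natCast, ← Real.rpow_add hzp]
      exact Real.rpow_le_one hzp.le h (by linarith [le_abs_self ((n : ℝ) + s)])
    have h2 := flat_bound H hH k m j x z
    calc _ = ‖z‖ ^ (-(n + s)) * (‖x‖ ^ k * ‖iteratedFDeriv ℝ j H (x, z)‖) *
          (1 + ‖z‖) ^ (n + 1) := by ring
      _ ≤ ‖z‖ ^ (-(n + s)) * (‖z‖ ^ m * A) * (1 + 1) ^ (n + 1) := by gcongr
      _ = (‖z‖ ^ (-(n + s)) * ‖z‖ ^ m) * (A * (1 + 1) ^ (n + 1)) := by ring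
      _ ≤ 1 * (A * (1 + 1) ^ (n + 1)) := by gcongr
      _ ≤ 2 ^ (n + 1) * (A + B) := by
        have : 0 ≤ (2 : ℝ) ^ (n + 1) * B := by positivity
        norm_num; linarith
  · have h1 : ‖z‖ ^ (-(n + s)) ≤ ‖z‖ ^ m := by
      rw [← Real.rpow_natCast ‖z‖ m]
      exact Real.rpow_le_rpow_of_exponent_le h (by linarith [neg_abs_le ((n : ℝ) + s)])
    have hx' : ‖x‖ ≤ ‖(x, z)‖ := norm_fst_le (x, z)
    have hz' : ‖z‖ ≤ ‖(x, z)‖ := norm_snd_le (x, z)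
    calc _ ≤ ‖x‖ ^ k * (‖z‖ ^ m * ‖iteratedFDeriv ℝ j H (x, z)‖) *
          (‖z‖ + ‖z‖) ^ (n + 1) := by gcongr
      _ = 2 ^ (n + 1) * (‖x‖ ^ k * ‖z‖ ^ m * ‖z‖ ^ (n + 1) *
          ‖iteratedFDeriv ℝ j H (x, z)‖) := by rw [← two_mul, mul_pow]; ring
      _ ≤ 2 ^ (n + 1) * (‖(x, z)‖ ^ k * ‖(x, z)‖ ^ m * ‖(x, z)‖ ^ (n + 1) *
          ‖iteratedFDeriv ℝ j H (x, z)‖) := by gcongr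
      _ = 2 ^ (n + 1) * (‖(x, z)‖ ^ (k + m + (n + 1)) *
          ‖iteratedFDeriv ℝ j H (x, z)‖) := by
        rw [pow_add ‖(x, z)‖ (k + m), pow_add ‖(x, z)‖ k]
      _ ≤ 2 ^ (n + 1) * B := by
        gcongr; exact SchwartzMap.le_seminorm ℂ _ j H (x, z)
      _ ≤ 2 ^ (n + 1) * (A + B) := by gcongr; linarith

theorem integrable_weight :
    Integrable (fun z : Rn n => (1 + ‖z‖) ^ (-((n : ℝ) + 1))) :=
  integrable_one_add_norm (by simp)

theorem meas_slice (s : ℝ) (H : 𝓢(Rn n × Rn n, ℂ)) (j : ℕ) (x : Rn n) :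
    AEStronglyMeasurable
      (fun z : Rn n => ‖z‖ ^ (-(n + s)) • iteratedFDeriv ℝ j (fun x => H (x, z)) x) := by
  have hw : AEStronglyMeasurable (fun z : Rn n => ‖z‖ ^ (-(n + s))) :=
    (measurable_norm.pow_const _).aestronglyMeasurable
  refine hw.smul ?_
  simp_rw [slice_iter]
  refine Continuous.aestronglyMeasurable ?_
  have hc : Continuous (iteratedFDeriv ℝ j H) := (H.smooth j).continuous_iteratedFDeriv le_rfl
  let L : ContinuousMultilinearMap ℝ (fun _ : Fin j => Rn n × Rn n) ℂ →L[ℝ]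
      ContinuousMultilinearMap ℝ (fun _ : Fin j => Rn n) ℂ :=
    ContinuousMultilinearMap.compContinuousLinearMapL
      (fun _ : Fin j => ContinuousLinearMap.inl ℝ (Rn n) (Rn n))
  exact L.continuous.comp
    (hc.comp (by fun_prop : Continuous fun z : Rn n => (x, z)))

theorem slice_bound (s : ℝ) (H : 𝓢(Rn n × Rn n, ℂ))
    (hH : ∀ (k : ℕ) (x : Rn n), iteratedFDeriv ℝ k H (x, 0) = 0) (k j : ℕ) (x z : Rn n) :
    ‖x‖ ^ k * ‖‖z‖ ^ (-(n + s)) • iteratedFDeriv ℝ j (fun x => H (x, z)) x‖ ≤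
      2 ^ (n + 1) * ctrl n s k j H * (1 + ‖z‖) ^ (-((n : ℝ) + 1)) := by
  refine le_trans ?_ (kernel_bound s H hH k j x z)
  rw [norm_smul, Real.norm_of_nonneg (by positivity)]
  gcongr
  exact norm_slice_iter_le H j x z

theorem integrable_slice (s : ℝ) (H : 𝓢(Rn n × Rn n, ℂ))
    (hH : ∀ (k : ℕ) (x : Rn n), iteratedFDeriv ℝ k H (x, 0) = 0) (j : ℕ) (x : Rn n) :
    Integrable
      (fun z : Rn n => ‖z‖ ^ (-(n + s)) • iteratedFDeriv ℝ j (fun x => H (x, z)) x) := by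
  refine (integrable_weight.const_mul (2 ^ (n + 1) * ctrl n s 0 j H)).mono'
    (meas_slice s H j x) (Filter.Eventually.of_forall fun z => ?_)
  simpa using slice_bound s H hH 0 j x z

theorem taylor (s : ℝ) (H : 𝓢(Rn n × Rn n, ℂ))
    (hH : ∀ (k : ℕ) (x : Rn n), iteratedFDeriv ℝ k H (x, 0) = 0) :
    HasFTaylorSeriesUpTo ∞ (fun x => ∫ z : Rn n, ‖z‖ ^ (-(n + s)) • H (x, z))
      (fun x j => ∫ z : Rn n, ‖z‖ ^ (-(n + s)) • iteratedFDeriv ℝ j (fun x => H (x, z)) x) := by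
  have hder : ∀ (m : ℕ) (x : Rn n), HasFDerivAt
      (fun x => ∫ z : Rn n, ‖z‖ ^ (-(n + s)) • iteratedFDeriv ℝ m (fun x => H (x, z)) x)
      (∫ z : Rn n, ‖z‖ ^ (-(n + s)) •
        iteratedFDeriv ℝ (m + 1) (fun x => H (x, z)) x).curryLeft x := by
    intro m x
    have hcl : (∫ z : Rn n, ‖z‖ ^ (-(n + s)) •
        iteratedFDeriv ℝ (m + 1) (fun x => H (x, z)) x).curryLeft =
        ∫ z : Rn n, (‖z‖ ^ (-(n + s)) •
          iteratedFDeriv ℝ (m + 1) (fun x => H (x, z)) x).curryLeft := by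
      let L : ContinuousMultilinearMap ℝ (fun _ : Fin (m + 1) => Rn n) ℂ →L[ℝ]
          (Rn n →L[ℝ] ContinuousMultilinearMap ℝ (fun _ : Fin m => Rn n) ℂ) :=
        (continuousMultilinearCurryLeftEquiv ℝ (fun _ : Fin (m + 1) => Rn n)
          ℂ).toContinuousLinearEquiv.toContinuousLinearMap
      exact (ContinuousLinearMap.integral_comp_comm (𝕜 := ℝ)
        (E := ContinuousMultilinearMap ℝ (fun _ : Fin (m + 1) => Rn n) ℂ)
        (Fₗ := Rn n →L[ℝ] ContinuousMultilinearMap ℝ (fun _ : Fin m => Rn n) ℂ)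
        L (integrable_slice s H hH (m + 1) x)).symm
    rw [hcl]
    refine hasFDerivAt_integral_of_dominated_of_fderiv_le (𝕜 := ℝ)
      (F' := fun x z => (‖z‖ ^ (-(n + s)) •
          iteratedFDeriv ℝ (m + 1) (fun x => H (x, z)) x).curryLeft)
      (bound := fun z => 2 ^ (n + 1) * ctrl n s 0 (m + 1) H * (1 + ‖z‖) ^ (-((n : ℝ) + 1)))
      Filter.univ_mem
      (Filter.Eventually.of_forall fun x => meas_slice s H m x) (integrable_slice s H hH m x)
      ?_ (Filter.Eventually.of_forall fun z x _ => ?_) (integrable_weight.const_mul _)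
      (Filter.Eventually.of_forall fun z x _ => ?_)
    · exact (continuousMultilinearCurryLeftEquiv ℝ (fun _ : Fin (m + 1) => Rn n)
        ℂ).continuous.comp_aestronglyMeasurable (meas_slice s H (m + 1) x)
    · rw [ContinuousMultilinearMap.curryLeft_norm]
      simpa using slice_bound s H hH 0 (m + 1) x z
    · have hsm : ContDiff ℝ ∞ (fun x => H (x, z)) :=
        (H.smooth (⊤ : ℕ∞)).comp (contDiff_id.prodMk contDiff_const)
      have := hsm.ftaylorSeries.fderiv m (by exact_mod_cast ENat.natCast_lt_top m) x
      exact this.const_smul (‖z‖ ^ (-(n + s)))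
  refine ⟨fun x => ?_, fun m _ x => hder m x, fun m _ =>
    continuous_iff_continuousAt.2 fun x => (hder m x).continuousAt⟩
  have h := (continuousMultilinearCurryFin0 ℝ (Rn n)
    ℂ).toContinuousLinearEquiv.toContinuousLinearMap.integral_comp_comm
      (integrable_slice s H hH 0 x)
  refine h.symm.trans (integral_congr_ae (Filter.Eventually.of_forall fun z => ?_))
  simp

/-- The shear `(x, z) ↦ (x, x + z)`. -/
def shear (n : ℕ) : (Rn n × Rn n) ≃L[ℝ] (Rn n × Rn n) :=
  (ContinuousLinearEquiv.refl ℝ (Rn n)).skewProd (ContinuousLinearEquiv.refl ℝ (Rn n))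
    (ContinuousLinearMap.id ℝ (Rn n))

/-- The function `2 G` in the variables `(x, y - x)`. -/
def sheared (n : ℕ) : offDiagSchwartz n →L[ℂ] 𝓢(Rn n × Rn n, ℂ) :=
  ((2 : ℂ) • compCLMOfContinuousLinearEquiv ℂ (shear n)).comp (offDiagSchwartz n).subtypeL

theorem sheared_apply (G : offDiagSchwartz n) (x z : Rn n) :
    sheared n G (x, z) = 2 * G.1 (x, z + x) := by
  simp [sheared, shear]

theorem sheared_flat (G : offDiagSchwartz n) (k : ℕ) (x : Rn n) :
    iteratedFDeriv ℝ k (sheared n G) (x, 0) = 0 := by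
  have h1 : (sheared n G : Rn n × Rn n → ℂ) =
      ((2 : ℂ) • ⇑G.1) ∘ (shear n).toContinuousLinearMap := by
    ext ⟨x, z⟩; rw [sheared_apply]; simp [shear]
  have hs : ContDiff ℝ k ((2 : ℂ) • ⇑G.1) := (G.1.smooth k).const_smul (2 : ℂ)
  have hx : (shear n).toContinuousLinearMap (x, 0) = (x, x) := by simp [shear]
  rw [h1, ContinuousLinearMap.iteratedFDeriv_comp_right _ hs _ le_rfl, hx,
    iteratedFDeriv_const_smul_apply (G.1.smooth k).contDiffAt, G.2.2, smul_zero]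
  ext; simp

theorem fracDivFun_eq (s : ℝ) (G : offDiagSchwartz n) (x : Rn n) :
    fracDivFun s G.1 x = ∫ z : Rn n, ‖z‖ ^ (-(n + s)) • sheared n G (x, z) := by
  unfold fracDivFun
  rw [← integral_add_right_eq_self _ x]
  refine integral_congr_ae (Filter.Eventually.of_forall fun z => ?_)
  simp only [sheared_apply]
  have : ‖x - (z + x)‖ = ‖z‖ := by rw [sub_add_cancel_right, norm_neg]
  rw [this]

theorem fracDivFun_smooth (s : ℝ) (G : offDiagSchwartz n) :
    ContDiff ℝ ∞ (fracDivFun s G.1) := by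
  rw [funext (fracDivFun_eq s G)]
  exact (taylor s _ (sheared_flat G)).contDiff

theorem fracDivFun_bound (s : ℝ) (G : offDiagSchwartz n) (k j : ℕ) (x : Rn n) :
    ‖x‖ ^ k * ‖iteratedFDeriv ℝ j (fracDivFun s G.1) x‖ ≤
      (2 ^ (n + 1) * ∫ z : Rn n, (1 + ‖z‖) ^ (-((n : ℝ) + 1))) *
        ctrl n s k j (sheared n G) := by
  rw [funext (fracDivFun_eq s G), ← (taylor s _ (sheared_flat G)).eq_iteratedFDeriv
    (by exact_mod_cast le_top) x]
  calc _ ≤ ‖x‖ ^ k * ∫ z : Rn n, ‖‖z‖ ^ (-(n + s)) •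
        iteratedFDeriv ℝ j (fun x => sheared n G (x, z)) x‖ := by
        gcongr; exact norm_integral_le_integral_norm _
    _ = ∫ z : Rn n, ‖x‖ ^ k * ‖‖z‖ ^ (-(n + s)) •
        iteratedFDeriv ℝ j (fun x => sheared n G (x, z)) x‖ := (integral_const_mul _ _).symm
    _ ≤ ∫ z : Rn n, 2 ^ (n + 1) * ctrl n s k j (sheared n G) *
        (1 + ‖z‖) ^ (-((n : ℝ) + 1)) :=
        integral_mono ((integrable_slice s _ (sheared_flat G) j x).norm.const_mul _)
          (integrable_weight.const_mul _) fun z => slice_bound s _ (sheared_flat G) k j x z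
    _ = _ := by rw [integral_const_mul]; ring

theorem fracDivFun_integrable (s : ℝ) (G : offDiagSchwartz n) (x : Rn n) :
    Integrable (fun y => ‖x - y‖ ^ (-(n + s)) • (2 * G.1 (x, y))) := by
  have h := (integrable_slice s _ (sheared_flat G) 0 x).norm
  have h2 : Integrable (fun z : Rn n => ‖z‖ ^ (-(n + s)) • sheared n G (x, z)) := by
    have h3 := (continuousMultilinearCurryFin0 ℝ (Rn n)
      ℂ).toContinuousLinearEquiv.toContinuousLinearMap.integrable_comp
        (integrable_slice s _ (sheared_flat G) 0 x)
    refine h3.congr (Filter.Eventually.of_forall fun z => ?_)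
    simp
  have h4 := h2.comp_sub_right x
  refine h4.congr (Filter.Eventually.of_forall fun y => ?_)
  simp [sheared_apply, norm_sub_rev]

end Aux

/-- The fractional divergence as a linear map from off-diagonal Schwartz functions on
`ℝⁿ × ℝⁿ` to Schwartz functions on `ℝⁿ`. -/
def fracDivLM {n : ℕ} (s : ℝ) : offDiagSchwartz n →ₗ[ℂ] 𝓢(Rn n, ℂ) where
  toFun G :=
    { toFun := fracDivFun s G.1
      smooth' := fracDivFun_smooth s G
      decay' := fun k j => ⟨_, fracDivFun_bound s G k j⟩ }
  map_add' F G := by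
    ext x
    change fracDivFun s (F.1 + G.1) x = fracDivFun s F.1 x + fracDivFun s G.1 x
    unfold fracDivFun
    rw [← integral_add (fracDivFun_integrable s F x) (fracDivFun_integrable s G x)]
    simp [mul_add]
  map_smul' c G := by
    ext x
    change fracDivFun s (c • G.1) x = c • fracDivFun s G.1 x
    unfold fracDivFun
    rw [← integral_smul]
    congr 1
    ext y
    simp only [smul_apply, smul_eq_mul, Complex.real_smul]
    ring

theorem fracDivLM_continuous {n : ℕ} (s : ℝ) : Continuous (fracDivLM (n := n) s) := by
  have hI : (0 : ℝ) ≤ 2 ^ (n + 1) * ∫ z : Rn n, (1 + ‖z‖) ^ (-((n : ℝ) + 1)) := by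
    have : 0 ≤ ∫ z : Rn n, (1 + ‖z‖) ^ (-((n : ℝ) + 1)) :=
      integral_nonneg fun z => by positivity
    positivity
  refine (schwartz_withSeminorms ℂ (Rn n) ℂ).continuous_of_continuous_comp
    (fracDivLM s) fun i => ?_
  have hc : Continuous (ctrl n s i.1 i.2) :=
    ((schwartz_withSeminorms ℂ (Rn n × Rn n) ℂ).continuous_seminorm (i.1, i.2 + ord n s)).add
      ((schwartz_withSeminorms ℂ (Rn n × Rn n) ℂ).continuous_seminorm
        (i.1 + ord n s + (n + 1), i.2))
  let C : NNReal := ⟨2 ^ (n + 1) * ∫ z : Rn n, (1 + ‖z‖) ^ (-((n : ℝ) + 1)), hI⟩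
  let q : Seminorm ℂ (offDiagSchwartz n) :=
    C • (ctrl n s i.1 i.2).comp (sheared n).toLinearMap
  have hq : Continuous q :=
    (hc.comp (sheared n).continuous).const_smul C
  have hle : (schwartzSeminormFamily ℂ (Rn n) ℂ i).comp (fracDivLM s) ≤ q := fun G =>
    SchwartzMap.seminorm_le_bound ℂ i.1 i.2 (fracDivLM s G)
      (mul_nonneg hI (apply_nonneg _ _)) (fracDivFun_bound s G i.1 i.2)
  exact Seminorm.continuous_of_le hq hle

/-- The fractional divergence as a continuous linear map from off-diagonal Schwartz functions on
`ℝⁿ × ℝⁿ` to Schwartz functions on `ℝⁿ`. -/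
def fracDiv {n : ℕ} (s : ℝ) : offDiagSchwartz n →L[ℂ] 𝓢(Rn n, ℂ) where
  toLinearMap := fracDivLM s
  cont := fracDivLM_continuous s

@[simp] theorem fracDiv_apply {n : ℕ} (s : ℝ) (G : offDiagSchwartz n) (x : Rn n) :
    fracDiv s G x = ∫ y, ‖x - y‖ ^ (-(n + s)) • (2 * G.1 (x, y)) := rfl

/-! ### The fractional gradient and the spaces `L^p_od` -/

/-- The fractional gradient `d_s u` of a tempered distribution `u`, as an off-diagonal tempered
distribution: `⟨d_s u, G⟩ = ⟨u, div_s G⟩`. -/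
def fracGrad {n : ℕ} (s : ℝ) (u : 𝓢'(Rn n, ℂ)) : offDiagSchwartz n →L[ℂ] ℂ where
  toFun G := u (fracDiv s G)
  map_add' F G := by rw [map_add, map_add]
  map_smul' c G := by rw [map_smul, map_smul, RingHom.id_apply]
  cont := (map_continuous u).comp (fracDiv s).continuous

/-- The measure `dx dy / |x - y|^n` on `ℝⁿ × ℝⁿ`. -/
def offDiagMeasure (n : ℕ) : Measure (Rn n × Rn n) :=
  volume.withDensity fun z => ENNReal.ofReal ((‖z.1 - z.2‖ ^ n)⁻¹)

/-- `‖F‖_{L^p_od} = (∬ |F(x,y)|^p dx dy / |x - y|^n)^{1/p}` -/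
def normLpOd {n : ℕ} (p : ℝ) (F : Rn n × Rn n → ℂ) : ℝ≥0∞ :=
  eLpNorm F (ENNReal.ofReal p) (offDiagMeasure n)

/-- `F ∈ L^p_od(ℝ²ⁿ)`: `F` is measurable, antisymmetric, and has finite norm. -/
structure MemLpOd {n : ℕ} (p : ℝ) (F : Rn n × Rn n → ℂ) : Prop where
  aestronglyMeasurable : AEStronglyMeasurable F volume
  antisymm : ∀ᵐ z : Rn n × Rn n, F (z.2, z.1) = -F z
  norm_lt_top : normLpOd p F < ⊤

/-- The off-diagonal distribution `T` is given by the function `F`: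
`⟨T, G⟩ = ∬ F(x,y) G(x,y) dx dy / |x - y|^n`. -/
def IsGivenBy {n : ℕ} (T : offDiagSchwartz n →L[ℂ] ℂ) (F : Rn n × Rn n → ℂ) : Prop :=
  ∀ G : offDiagSchwartz n, T G = ∫ z, F z * G.1 z ∂(offDiagMeasure n)

/-- The constant `C`, as a tempered distribution `φ ↦ C ∫ φ`. -/
def constDistribution {n : ℕ} (C : ℂ) : 𝓢'(Rn n, ℂ) :=
  C • (volume : Measure (Rn n)).toTemperedDistribution

/-- A tempered distribution is real if it takes real values on real test functions. -/
def IsRealDistribution {n : ℕ} (u : 𝓢'(Rn n, ℂ)) : Prop :=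
  ∀ φ : 𝓢(Rn n, ℂ), (∀ x, (φ x).im = 0) → (u φ).im = 0

end FracGrad

end

noncomputable section

namespace FracGrad

/-! Testing `d_s u = F` against `|x-y|^(n+s)` times an antisymmetrized test function `g` supported
off the diagonal cancels the singular kernel and gives `⟨u, ∫ (g(x,y) - g(y,x)) dy⟩ = ∬ H g` with `H
= |x-y|^s F` (`apply_fracDiv_weightedAntisymmOd`). For `g = φ ⊗ χ` with disjoint supports and `∫ χ =
1`, this shows that `u` is a function away from the support of `χ`. Two choices of `χ` and a
partition of unity yield a locally integrable `w` representing `u` (`exists_locallyIntegrable`).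
General `g` then gives `w(x) - w(y) = H(x,y)` almost everywhere (`ae_difference_eq`), so the
`L^p_od` norm of `F` is the Gagliardo seminorm of `w`.

What remains is the fractional Sobolev inequality modulo constants. For bounded `v` of mean zero on
a ball, comparing `v(x)` with averages at scale `r` and optimizing in `r` gives `|v(x)| ≤ C
α(x)^(p/q) ‖v‖_q^(sp/n)`, where `α(x)^p` is the Gagliardo integral at `x` (`pointwise_bound`). The
`q`-th power of the right side is linear in `α^p`, so integrating and absorbing the power of `‖v‖_q`
proves the inequality on balls, including `p = 1`, with a constant independent of the radius
(`poincare_sobolev_ball`). Truncation, exhaustion by balls and Fatou's lemma carry it to `ℝⁿ`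
(`exists_eLpNorm_sub_const_le`). -/

/-! ### Pointwise estimate and Poincaré–Sobolev inequality on balls -/

/-- Since `s + N/q = N/p`, the two terms of `h1` are equal at `r = (A/α)^(p/N)`. If this radius is
at least `R`, or if `α = 0`, then `h2` alone is strong enough. -/
theorem le_of_forall_radius {N s p q α A t C R : ℝ} (hN : 0 < N) (hs : 0 < s) (hp : 1 ≤ p)
    (hq0 : 0 < q) (hq : 1 / q = 1 / p - s / N) (hα : 0 ≤ α) (hA : 0 < A) (hC : 0 ≤ C)
    (hR : 0 < R)
    (h1 : ∀ r, 0 < r → r ≤ R → t ≤ C * (r ^ s * α + r ^ (-(N / q)) * A))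
    (h2 : t ≤ C * (R ^ s * α)) :
    t ≤ 2 * C * (α ^ (p / q) * A ^ (s * p / N)) := by
  have hp0 : 0 < p := by linarith
  have hθ : s * p / N + p / q = 1 := by
    have : p / q = p * (1 / q) := by ring
    rw [this, hq]; field_simp; ring
  have hpN : 0 < p / N := by positivity
  have hα1 : α = α ^ (s * p / N) * α ^ (p / q) := by
    rw [← Real.rpow_add_of_nonneg hα (by positivity) (by positivity), hθ, Real.rpow_one]
  have hA1 : A = A ^ (s * p / N) * A ^ (p / q) := by
    rw [← Real.rpow_add_of_nonneg hA.le (by positivity) (by positivity), hθ, Real.rpow_one]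
  have hX : 0 ≤ C * (α ^ (p / q) * A ^ (s * p / N)) := by positivity
  rcases le_or_gt (R * α ^ (p / N)) (A ^ (p / N)) with h | h
  · have h3 : R ^ s * α ^ (s * p / N) ≤ A ^ (s * p / N) := by
      have := Real.rpow_le_rpow (by positivity) h hs.le
      rw [Real.mul_rpow hR.le (by positivity), ← Real.rpow_mul hα, ← Real.rpow_mul hA.le] at this
      rwa [show p / N * s = s * p / N by ring] at this
    calc t ≤ C * (R ^ s * α) := h2
      _ = C * (R ^ s * α ^ (s * p / N) * α ^ (p / q)) := by rw [mul_assoc, ← hα1]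
      _ ≤ C * (A ^ (s * p / N) * α ^ (p / q)) := by gcongr
      _ = C * (α ^ (p / q) * A ^ (s * p / N)) := by ring
      _ ≤ _ := by linarith
  · have hα0 : 0 < α := by
      rcases hα.eq_or_lt with h0 | h0
      · rw [← h0, Real.zero_rpow hpN.ne', mul_zero] at h
        exact absurd h (not_lt.2 (by positivity))
      · exact h0
    have hr : 0 < (A / α) ^ (p / N) := by positivity
    have hrR : (A / α) ^ (p / N) ≤ R := by
      rw [Real.div_rpow hA.le hα, div_le_iff₀ (by positivity)]
      exact h.le
    have h3 := h1 _ hr hrR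
    have e1 : ((A / α) ^ (p / N)) ^ s * α = α ^ (p / q) * A ^ (s * p / N) := by
      rw [← Real.rpow_mul (by positivity), show p / N * s = s * p / N by ring,
        Real.div_rpow hA.le hα]
      nth_rewrite 2 [hα1]
      field_simp
    have e2 : ((A / α) ^ (p / N)) ^ (-(N / q)) * A = α ^ (p / q) * A ^ (s * p / N) := by
      rw [← Real.rpow_mul (by positivity),
        show p / N * -(N / q) = -(p / q) by field_simp, Real.rpow_neg (by positivity),
        Real.div_rpow hA.le hα]
      nth_rewrite 2 [hA1]
      field_simp
    rw [e1, e2] at h3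
    linarith

/-- The `p`-th power of the Gagliardo seminorm, localized at one point. -/
def gagliardoAt {n : ℕ} (s p : ℝ) (f : Rn n → ℂ) (x : Rn n) : ℝ≥0∞ :=
  ∫⁻ y, ‖f x - f y‖ₑ ^ p * ENNReal.ofReal (‖x - y‖ ^ (-(n + s * p)))

/-- The `p`-th power of the Gagliardo seminorm. -/
def gagliardo {n : ℕ} (s p : ℝ) (f : Rn n → ℂ) : ℝ≥0∞ :=
  ∫⁻ x, gagliardoAt s p f x

theorem gagliardo_mono {n : ℕ} {s p : ℝ} (hp : 0 ≤ p) {f g : Rn n → ℂ}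
    (h : ∀ x y, ‖f x - f y‖ ≤ ‖g x - g y‖) : gagliardo s p f ≤ gagliardo s p g := by
  refine lintegral_mono fun x => lintegral_mono fun y => ?_
  gcongr
  exact enorm_le_iff_norm_le.2 (h x y)

variable {n : ℕ}

theorem lintegral_enorm_le_rpow (ν : Measure (Rn n)) {p : ℝ} (hp : 1 ≤ p) {h : Rn n → ℂ}
    (hh : AEStronglyMeasurable h ν) :
    ∫⁻ y, ‖h y‖ₑ ∂ν ≤ (∫⁻ y, ‖h y‖ₑ ^ p ∂ν) ^ (1 / p) * ν Set.univ ^ (1 - 1 / p) := by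
  have hp0 : 0 < p := by linarith
  have := eLpNorm_le_eLpNorm_mul_rpow_measure_univ (p := 1) (q := ENNReal.ofReal p)
    (by simpa using hp) hh
  rw [eLpNorm_one_eq_lintegral_enorm, eLpNorm_eq_lintegral_rpow_enorm_toReal (by simpa using hp0)
    (by simp), ENNReal.toReal_ofReal hp0.le] at this
  simpa using this

/-- Averaging over a ball of radius `r / 2` at distance at most `r` from `x`. -/
theorem average_diff_bound {s p : ℝ} (hs : 0 < s) (hp : 1 ≤ p) {v : Rn n → ℂ}
    (hv : AEStronglyMeasurable v) (x z : Rn n) {r : ℝ} (hr : 0 < r)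
    (hE : ∀ y ∈ Metric.ball z (r / 2), ‖x - y‖ ≤ r) :
    ∫⁻ y in Metric.ball z (r / 2), ‖v x - v y‖ₑ ≤
      ENNReal.ofReal (r ^ (s + n / p)) * gagliardoAt s p v x ^ (1 / p) *
        volume (Metric.ball z (r / 2)) ^ (1 - 1 / p) := by
  have hp0 : 0 < p := by linarith
  have h1 := lintegral_enorm_le_rpow (volume.restrict (Metric.ball z (r / 2))) hp
    (h := fun y => v x - v y) (aestronglyMeasurable_const.sub hv.restrict)
  rw [Measure.restrict_apply_univ] at h1
  refine h1.trans ?_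
  gcongr
  have h2 : ∫⁻ y in Metric.ball z (r / 2), ‖v x - v y‖ₑ ^ p ≤
      ENNReal.ofReal (r ^ (n + s * p)) * gagliardoAt s p v x := by
    rw [gagliardoAt, ← lintegral_const_mul' _ _ ENNReal.ofReal_ne_top]
    refine le_trans (setLIntegral_mono' Metric.isOpen_ball.measurableSet fun y hy => ?_)
      (setLIntegral_le_lintegral _ _)
    rcases eq_or_ne x y with rfl | hxy
    · simp [ENNReal.zero_rpow_of_pos hp0]
    have hxy' : 0 < ‖x - y‖ := norm_pos_iff.2 (sub_ne_zero.2 hxy)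
    calc ‖v x - v y‖ₑ ^ p = ‖v x - v y‖ₑ ^ p * 1 := (mul_one _).symm
      _ ≤ ‖v x - v y‖ₑ ^ p * ENNReal.ofReal (r ^ (n + s * p) * ‖x - y‖ ^ (-(n + s * p))) := by
        gcongr
        rw [ENNReal.one_le_ofReal, Real.rpow_neg hxy'.le, ← div_eq_mul_inv,
          ← Real.div_rpow hr.le hxy'.le]
        exact Real.one_le_rpow ((one_le_div hxy').2 (hE y hy)) (by positivity)
      _ = _ := by rw [ENNReal.ofReal_mul (by positivity)]; ring
  calc _ ≤ (ENNReal.ofReal (r ^ (n + s * p)) * gagliardoAt s p v x) ^ (1 / p) := by gcongr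
    _ = _ := by
      rw [ENNReal.mul_rpow_of_nonneg _ _ (by positivity),
        ENNReal.ofReal_rpow_of_nonneg (by positivity) (by positivity), ← Real.rpow_mul hr.le]
      congr 3
      field_simp
      ring

theorem volume_ball_half (z : Rn n) {r : ℝ} (hr : 0 < r) :
    volume (Metric.ball z (r / 2)) =
      ENNReal.ofReal (volume.real (Metric.ball (0 : Rn n) 1) / 2 ^ n * r ^ n) := by
  rw [Measure.addHaar_ball_of_pos _ _ (by positivity), ← ofReal_measureReal measure_ball_lt_top.ne,
    ← ENNReal.ofReal_mul (by positivity)]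
  congr 1
  simp only [finrank_euclideanSpace, Fintype.card_fin, div_pow]
  ring

/-- Average `|v(x)| ≤ |v(x) - v(y)| + |v(y)|` over a ball of radius `r/2` inside the large ball and
within distance `r` of `x`. By Hölder the two averages are at most constants times `r^s α` and
`r^(-n/q) ‖v‖_q`. At `r = 2R` the small ball is the whole ball and the zero mean removes the second
term. `le_of_forall_radius` then chooses `r`. -/
theorem pointwise_bound {s p q : ℝ} (hn : 0 < n) (hs : 0 < s) (hp : 1 ≤ p) (hq1 : 1 ≤ q)
    (hq : 1 / q = 1 / p - s / n) : ∃ C : ℝ, 0 < C ∧ ∀ (v : Rn n → ℂ) (R : ℝ), 0 < R →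
      AEStronglyMeasurable v → (∃ M, ∀ x, ‖v x‖ ≤ M) → ∫ y in Metric.ball 0 R, v y = 0 →
      0 < ∫⁻ y in Metric.ball (0 : Rn n) R, ‖v y‖ₑ ^ q →
      ∀ x ∈ Metric.ball (0 : Rn n) R, ‖v x‖ₑ ≤ ENNReal.ofReal C *
        ((gagliardoAt s p v x ^ (1 / p)) ^ (p / q) *
        ((∫⁻ y in Metric.ball (0 : Rn n) R, ‖v y‖ₑ ^ q) ^ (1 / q)) ^ (s * p / n)) := by
  have hp0 : 0 < p := by linarith
  have hq0 : 0 < q := by linarith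
  -- A ball of radius `r / 2` has volume `b * r ^ n`.
  set b := volume.real (Metric.ball (0 : Rn n) 1) / 2 ^ n with hb
  have hb0 : 0 < b := by
    have : 0 < volume.real (Metric.ball (0 : Rn n) 1) :=
      ENNReal.toReal_pos (Metric.measure_ball_pos _ _ one_pos).ne' measure_ball_lt_top.ne
    positivity
  refine ⟨2 * (b ^ (-(1 / p)) + b ^ (-(1 / q))), by positivity, ?_⟩
  rintro v R hR hv ⟨M, hM⟩ hmean hA x hx
  set A := (∫⁻ y in Metric.ball (0 : Rn n) R, ‖v y‖ₑ ^ q) with hAdef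
  have hAtop : A ≠ ⊤ := by
    refine ne_top_of_le_ne_top ?_ (lintegral_mono (g := fun _ => ENNReal.ofReal M ^ q) fun y => ?_)
    · rw [lintegral_const, Measure.restrict_apply_univ]
      exact ENNReal.mul_ne_top (by simp [hq0.le]) measure_ball_lt_top.ne
    · refine ENNReal.rpow_le_rpow ?_ hq0.le
      rw [← ofReal_norm]
      exact ENNReal.ofReal_le_ofReal (hM y)
  set a := gagliardoAt s p v x ^ (1 / p) with ha
  -- If the Gagliardo integral at `x` is infinite, so is the right side, because the factor
  -- containing `A` is positive.
  rcases eq_or_ne a ⊤ with hatop | hatop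
  · rw [hatop, ENNReal.top_rpow_of_pos (by positivity), ENNReal.top_mul, ENNReal.mul_top]
    · exact le_top
    · simpa using (by positivity : 0 < 2 * (b ^ (-(1 / p)) + b ^ (-(1 / q))))
    · exact (ENNReal.rpow_pos (ENNReal.rpow_pos hA hAtop)
        (ENNReal.rpow_ne_top_of_nonneg (by positivity) hAtop)).ne'
  have hA1top : A ^ (1 / q) ≠ ⊤ := ENNReal.rpow_ne_top_of_nonneg (by positivity) hAtop
  have hA1pos : 0 < (A ^ (1 / q)).toReal := ENNReal.toReal_pos (ENNReal.rpow_pos hA hAtop).ne' hA1top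
  have hvx : ‖v x‖ₑ = ENNReal.ofReal ‖v x‖ := (ofReal_norm _).symm
  -- the two basic estimates
  have key : ∀ r, 0 < r → ∀ z : Rn n, (∀ y ∈ Metric.ball z (r / 2), ‖x - y‖ ≤ r) →
      ∫⁻ y in Metric.ball z (r / 2), ‖v x - v y‖ₑ ≤
        ENNReal.ofReal ((b * r ^ n) * (b ^ (-(1 / p)) * (r ^ s * a.toReal))) := by
    intro r hr z hE
    refine (average_diff_bound hs hp hv x z hr hE).trans_eq ?_
    rw [← ha, volume_ball_half z hr, ← hb, ENNReal.ofReal_rpow_of_pos (by positivity),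
      ← ENNReal.ofReal_toReal hatop, ← ENNReal.ofReal_mul (by positivity),
      ← ENNReal.ofReal_mul (by positivity), ENNReal.toReal_ofReal (by positivity)]
    congr 1
    rw [Real.mul_rpow hb0.le (by positivity), ← Real.rpow_natCast r n, ← Real.rpow_mul hr.le,
      Real.rpow_add hr, Real.rpow_sub hb0, Real.rpow_one, Real.rpow_neg hb0.le, mul_sub,
      Real.rpow_sub hr, mul_one, show (n : ℝ) * (1 / p) = n / p by ring]
    field_simp
  have hbr : ∀ r, 0 < r → 0 < b * r ^ n := fun r hr => by positivity
  have hx' : ‖x‖ < R := by simpa using hx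
  rw [hvx, ← ENNReal.ofReal_toReal hatop, ← ENNReal.ofReal_toReal hA1top,
    ENNReal.ofReal_rpow_of_nonneg ENNReal.toReal_nonneg (by positivity),
    ENNReal.ofReal_rpow_of_nonneg ENNReal.toReal_nonneg (by positivity),
    ← ENNReal.ofReal_mul (by positivity), ← ENNReal.ofReal_mul (by positivity)]
  apply ENNReal.ofReal_le_ofReal
  refine le_of_forall_radius (R := 2 * R) (by exact_mod_cast hn) hs hp hq0 hq
    ENNReal.toReal_nonneg hA1pos (by positivity) (by positivity) ?_ ?_
  · intro r hr hrR
    -- The centre is moved from `x` towards the origin by at most `r / 2`, so that the ball stays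
    -- inside the large one even when `x` is near the boundary.
    set z : Rn n := (1 - r / (2 * R)) • x with hz
    have hρ : 0 ≤ 1 - r / (2 * R) := by
      rw [sub_nonneg, div_le_one (by positivity)]; exact hrR
    have hzx : ‖x - z‖ ≤ r / 2 := by
      have : x - z = (r / (2 * R)) • x := by rw [hz, sub_smul, one_smul]; abel
      rw [this, norm_smul, Real.norm_of_nonneg (by positivity)]
      calc r / (2 * R) * ‖x‖ ≤ r / (2 * R) * R := by gcongr
        _ = r / 2 := by field_simp
    have hE : ∀ y ∈ Metric.ball z (r / 2), ‖x - y‖ ≤ r := by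
      intro y hy
      rw [Metric.mem_ball, dist_comm, dist_eq_norm] at hy
      calc ‖x - y‖ = ‖(x - z) + (z - y)‖ := by congr 1; abel
        _ ≤ ‖x - z‖ + ‖z - y‖ := norm_add_le _ _
        _ ≤ r := by linarith
    have hsub : Metric.ball z (r / 2) ⊆ Metric.ball 0 R := by
      refine Metric.ball_subset_ball' ?_
      rw [dist_zero_right, hz, norm_smul, Real.norm_of_nonneg hρ]
      have : (1 - r / (2 * R)) * ‖x‖ ≤ (1 - r / (2 * R)) * R := by gcongr
      have e : (1 - r / (2 * R)) * R = R - r / 2 := by field_simp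
      linarith
    have h2 : ∫⁻ y in Metric.ball z (r / 2), ‖v y‖ₑ ≤
        ENNReal.ofReal ((b * r ^ n) * (b ^ (-(1 / q)) * (r ^ (-(n / q)) * (A ^ (1 / q)).toReal))) := by
      have h1 := lintegral_enorm_le_rpow (volume.restrict (Metric.ball z (r / 2))) hq1 hv.restrict
      rw [Measure.restrict_apply_univ] at h1
      have h3 : (∫⁻ y in Metric.ball z (r / 2), ‖v y‖ₑ ^ q) ≤ A := lintegral_mono_set hsub
      calc _ ≤ A ^ (1 / q) * volume (Metric.ball z (r / 2)) ^ (1 - 1 / q) := by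
            refine h1.trans ?_
            gcongr
        _ = _ := by
          rw [volume_ball_half z hr, ← hb, ENNReal.ofReal_rpow_of_pos (by positivity),
            ← ENNReal.ofReal_toReal hA1top, ← ENNReal.ofReal_mul (by positivity),
            ENNReal.toReal_ofReal (by positivity)]
          congr 1
          rw [Real.mul_rpow hb0.le (by positivity), ← Real.rpow_natCast r n, ← Real.rpow_mul hr.le,
            Real.rpow_sub hb0, Real.rpow_one, Real.rpow_neg hb0.le, mul_sub,
            Real.rpow_sub hr, mul_one, show (n : ℝ) * (1 / q) = n / q by ring, Real.rpow_neg hr.le]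
          field_simp
    have h4 : ENNReal.ofReal (‖v x‖ * (b * r ^ n)) ≤ ENNReal.ofReal
        ((b * r ^ n) * (b ^ (-(1 / p)) * (r ^ s * a.toReal)) +
        (b * r ^ n) * (b ^ (-(1 / q)) * (r ^ (-(n / q)) * (A ^ (1 / q)).toReal))) := by
      rw [ENNReal.ofReal_mul (norm_nonneg _), ← volume_ball_half z hr, ← hvx,
        ENNReal.ofReal_add (by positivity) (by positivity)]
      refine le_trans ?_ (add_le_add (key r hr z hE) h2)
      rw [← lintegral_add_right' _ hv.restrict.enorm, ← setLIntegral_const]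
      refine lintegral_mono fun y => ?_
      calc ‖v x‖ₑ = ‖(v x - v y) + v y‖ₑ := by rw [sub_add_cancel]
        _ ≤ _ := enorm_add_le _ _
    rw [ENNReal.ofReal_le_ofReal_iff (by positivity), ← mul_add, mul_comm] at h4
    have h5 := le_of_mul_le_mul_left h4 (hbr r hr)
    refine h5.trans ?_
    have i1 : 0 ≤ b ^ (-(1 / q)) * (r ^ s * a.toReal) := by positivity
    have i2 : 0 ≤ b ^ (-(1 / p)) * (r ^ (-(n / q)) * (A ^ (1 / q)).toReal) := by positivity
    nlinarith
  · have h2R : 2 * R / 2 = R := by ring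
    have hE : ∀ y ∈ Metric.ball (0 : Rn n) (2 * R / 2), ‖x - y‖ ≤ 2 * R := by
      intro y hy
      rw [h2R, mem_ball_zero_iff] at hy
      linarith [norm_sub_le x y]
    have h3 := key (2 * R) (by positivity) 0 hE
    have hvi : IntegrableOn v (Metric.ball 0 R) :=
      Measure.integrableOn_of_bounded measure_ball_lt_top.ne hv (M := M)
        (Filter.Eventually.of_forall hM)
    have h4 : ENNReal.ofReal (‖v x‖ * (b * (2 * R) ^ n)) ≤
        ENNReal.ofReal ((b * (2 * R) ^ n) * (b ^ (-(1 / p)) * ((2 * R) ^ s * a.toReal))) := by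
      refine le_trans ?_ h3
      -- The zero mean enters here: integrating `v x - v y` over the whole ball leaves only `v x`.
      have e : ∫ y in Metric.ball (0 : Rn n) (2 * R / 2), (v x - v y) =
          (b * (2 * R) ^ n : ℝ) • v x := by
        have e2 : volume.real (Metric.ball (0 : Rn n) (2 * R / 2)) = b * (2 * R) ^ n := by
          rw [measureReal_def, volume_ball_half 0 (by positivity : 0 < 2 * R),
            ENNReal.toReal_ofReal (by positivity)]
        have hc : Integrable (fun _ => v x)
            (volume.restrict (Metric.ball (0 : Rn n) (2 * R / 2))) :=
          (integrableOn_const_iff).2 (Or.inr measure_ball_lt_top)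
        have hvi' : Integrable v (volume.restrict (Metric.ball (0 : Rn n) (2 * R / 2))) := by
          rwa [h2R]
        rw [integral_sub hc hvi', setIntegral_const, e2, h2R, hmean, sub_zero]
      have h5 := enorm_integral_le_lintegral_enorm
        (μ := volume.restrict (Metric.ball (0 : Rn n) (2 * R / 2))) (fun y => v x - v y)
      rw [e] at h5
      refine le_trans (le_of_eq ?_) h5
      rw [← ofReal_norm, norm_smul, Real.norm_of_nonneg (by positivity), mul_comm]
    rw [ENNReal.ofReal_le_ofReal_iff (by positivity), mul_comm] at h4
    have h5 := le_of_mul_le_mul_left h4 (hbr (2 * R) (by positivity))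
    refine h5.trans ?_
    have i1 : 0 ≤ b ^ (-(1 / q)) * ((2 * R) ^ s * a.toReal) := by positivity
    nlinarith

theorem gagliardoAt_sub_const (s p : ℝ) (f : Rn n → ℂ) (c : ℂ) (x : Rn n) :
    gagliardoAt s p (fun x => f x - c) x = gagliardoAt s p f x := by
  simp [gagliardoAt]

/-- The fractional Poincaré–Sobolev inequality on balls for bounded functions, with a constant
which does not depend on the radius. -/
theorem poincare_sobolev_ball {s p q : ℝ} (hn : 0 < n) (hs : 0 < s) (hp : 1 ≤ p) (hq1 : 1 ≤ q)
    (hq : 1 / q = 1 / p - s / n) : ∃ C : ℝ, 0 < C ∧ ∀ (f : Rn n → ℂ) (R : ℝ), 0 < R →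
      AEStronglyMeasurable f → (∃ M, ∀ x, ‖f x‖ ≤ M) →
      (∫⁻ y in Metric.ball (0 : Rn n) R, ‖f y - ⨍ z in Metric.ball 0 R, f z‖ₑ ^ q) ^ (1 / q) ≤
        ENNReal.ofReal C * gagliardo s p f ^ (1 / p) := by
  have hp0 : 0 < p := by linarith
  have hq0 : 0 < q := by linarith
  have hn0 : (0 : ℝ) < n := by exact_mod_cast hn
  obtain ⟨C, hC, h⟩ := pointwise_bound hn hs hp hq1 hq
  refine ⟨C ^ (q / p), by positivity, ?_⟩
  rintro f R hR hf ⟨M, hM⟩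
  set c := ⨍ z in Metric.ball (0 : Rn n) R, f z with hc
  set A := ∫⁻ y in Metric.ball (0 : Rn n) R, ‖f y - c‖ₑ ^ q with hA
  have hbd : ∀ x, ‖f x - c‖ ≤ M + ‖c‖ := fun x =>
    (norm_sub_le _ _).trans (add_le_add_left (hM x) _)
  rcases eq_or_ne A 0 with h0 | h0
  · rw [h0, ENNReal.zero_rpow_of_pos (by positivity)]; exact zero_le
  have hAtop : A ≠ ⊤ := by
    refine ne_top_of_le_ne_top ?_
      (lintegral_mono (g := fun _ => ENNReal.ofReal (M + ‖c‖) ^ q) fun y => ?_)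
    · rw [lintegral_const, Measure.restrict_apply_univ]
      exact ENNReal.mul_ne_top (by simp [hq0.le]) measure_ball_lt_top.ne
    · refine ENNReal.rpow_le_rpow ?_ hq0.le
      rw [← ofReal_norm]
      exact ENNReal.ofReal_le_ofReal (hbd y)
  have hfi : IntegrableOn f (Metric.ball 0 R) :=
    Measure.integrableOn_of_bounded measure_ball_lt_top.ne hf (M := M)
      (Filter.Eventually.of_forall hM)
  have hmean : ∫ y in Metric.ball 0 R, (f y - c) = 0 := by
    have hci : IntegrableOn (fun _ => c) (Metric.ball (0 : Rn n) R) :=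
      (integrableOn_const_iff).2 (Or.inr measure_ball_lt_top)
    have : volume.real (Metric.ball (0 : Rn n) R) ≠ 0 :=
      (ENNReal.toReal_pos (Metric.measure_ball_pos _ _ hR).ne' measure_ball_lt_top.ne).ne'
    rw [integral_sub hfi hci, setIntegral_const, hc, setAverage_eq, smul_smul,
      mul_inv_cancel₀ this, one_smul, sub_self]
  have h1 := h (fun y => f y - c) R hR (hf.sub aestronglyMeasurable_const) ⟨_, hbd⟩ hmean
    (pos_iff_ne_zero.2 h0)
  simp only [gagliardoAt_sub_const, ← hA] at h1
  set θ := s * p / n with hθ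
  have hθ1 : θ + p / q = 1 := by
    have : p / q = p * (1 / q) := by ring
    rw [this, hq, hθ]; field_simp; ring
  have hθ0 : 0 ≤ θ := by positivity
  -- In the `q`-th power of the pointwise bound `gagliardoAt` appears to the first power, so
  -- integration in `x` produces the seminorm itself.
  have h2 : A ≤ ENNReal.ofReal C ^ q * A ^ θ * gagliardo s p f := by
    calc A ≤ ∫⁻ x in Metric.ball (0 : Rn n) R, ENNReal.ofReal C ^ q * A ^ θ * gagliardoAt s p f x := by
          refine setLIntegral_mono' Metric.isOpen_ball.measurableSet fun x hx => ?_
          refine (ENNReal.rpow_le_rpow (h1 x hx) hq0.le).trans_eq ?_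
          rw [ENNReal.mul_rpow_of_nonneg _ _ hq0.le, ENNReal.mul_rpow_of_nonneg _ _ hq0.le,
            ← ENNReal.rpow_mul, ← ENNReal.rpow_mul, ← ENNReal.rpow_mul, ← ENNReal.rpow_mul,
            show 1 / p * (p / q * q) = 1 by field_simp, ENNReal.rpow_one,
            show 1 / q * (θ * q) = θ by field_simp]
          ring
      _ ≤ ∫⁻ x, ENNReal.ofReal C ^ q * A ^ θ * gagliardoAt s p f x :=
          setLIntegral_le_lintegral _ _
      _ = _ := by
          rw [lintegral_const_mul', gagliardo]
          exact ENNReal.mul_ne_top (ENNReal.rpow_ne_top_of_nonneg hq0.le ENNReal.ofReal_ne_top)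
            (ENNReal.rpow_ne_top_of_nonneg hθ0 hAtop)
  have hAθ : A ^ θ ≠ ⊤ := ENNReal.rpow_ne_top_of_nonneg hθ0 hAtop
  have hAθ0 : A ^ θ ≠ 0 := (ENNReal.rpow_pos (pos_iff_ne_zero.2 h0) hAtop).ne'
  -- Absorption: `A ^ θ` is divided out, which is allowed because `A` is nonzero and, `f` being
  -- bounded, finite.
  have h3 : A ^ (p / q) ≤ ENNReal.ofReal C ^ q * gagliardo s p f := by
    have e : A = A ^ θ * A ^ (p / q) := by
      rw [← ENNReal.rpow_add _ _ h0 hAtop, hθ1, ENNReal.rpow_one]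
    have h4 : A ^ θ * A ^ (p / q) ≤ A ^ θ * (ENNReal.ofReal C ^ q * gagliardo s p f) := by
      rw [← e]; refine h2.trans_eq ?_; ring
    exact (ENNReal.mul_le_mul_iff_right hAθ0 hAθ).1 h4
  calc A ^ (1 / q) = (A ^ (p / q)) ^ (1 / p) := by
        rw [← ENNReal.rpow_mul]; congr 1; field_simp
    _ ≤ (ENNReal.ofReal C ^ q * gagliardo s p f) ^ (1 / p) := by gcongr
    _ = _ := by
        rw [ENNReal.mul_rpow_of_nonneg _ _ (by positivity), ← ENNReal.rpow_mul,
          ← ENNReal.ofReal_rpow_of_pos hC]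
        congr 2; ring

/-! ### Truncation and the Sobolev inequality modulo constants -/

/-- Truncation of the real and imaginary parts of a complex number at height `k`. -/
def truncate (k : ℝ) (z : ℂ) : ℂ := ⟨max (-k) (min z.re k), max (-k) (min z.im k)⟩

theorem abs_truncate_sub_le (k a b : ℝ) :
    |max (-k) (min a k) - max (-k) (min b k)| ≤ |a - b| := by
  refine (abs_max_sub_max_le_max _ _ _ _).trans ?_
  rw [sub_self, abs_zero]
  refine max_le (abs_nonneg _) ((abs_min_sub_min_le_max _ _ _ _).trans ?_)
  rw [sub_self, abs_zero]
  exact max_le le_rfl (abs_nonneg _)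

/-- Clamping is 1-Lipschitz in each coordinate. Hence truncating a function does not increase its
Gagliardo seminorm. -/
theorem norm_truncate_sub_le (k : ℝ) (z w : ℂ) : ‖truncate k z - truncate k w‖ ≤ ‖z - w‖ := by
  refine le_of_sq_le_sq ?_ (norm_nonneg _)
  rw [Complex.sq_norm, Complex.sq_norm, Complex.normSq_apply, Complex.normSq_apply, ← sq, ← sq,
    ← sq, ← sq]
  exact add_le_add (sq_le_sq.2 (abs_truncate_sub_le k z.re w.re))
    (sq_le_sq.2 (abs_truncate_sub_le k z.im w.im))

theorem truncate_of_norm_le {k : ℝ} {z : ℂ} (h : ‖z‖ ≤ k) : truncate k z = z := by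
  have h1 := abs_le.1 ((Complex.abs_re_le_norm z).trans h)
  have h2 := abs_le.1 ((Complex.abs_im_le_norm z).trans h)
  apply Complex.ext
  · simp only [truncate]; rw [min_eq_left h1.2, max_eq_right h1.1]
  · simp only [truncate]; rw [min_eq_left h2.2, max_eq_right h2.1]

theorem norm_truncate_le {k : ℝ} (hk : 0 ≤ k) (z : ℂ) : ‖truncate k z‖ ≤ ‖z‖ := by
  have h := norm_truncate_sub_le k z 0
  rwa [truncate_of_norm_le (by simpa using hk : ‖(0 : ℂ)‖ ≤ k), sub_zero, sub_zero] at h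

theorem norm_truncate_le_two_mul {k : ℝ} (hk : 0 ≤ k) (z : ℂ) : ‖truncate k z‖ ≤ 2 * k := by
  have h (a : ℝ) : |max (-k) (min a k)| ≤ k :=
    abs_le.2 ⟨le_max_left _ _, max_le (by linarith) (min_le_right _ _)⟩
  have := Complex.norm_le_abs_re_add_abs_im (truncate k z)
  have h1 : |(truncate k z).re| ≤ k := h _
  have h2 : |(truncate k z).im| ≤ k := h _
  linarith

theorem continuous_truncate (k : ℝ) : Continuous (truncate k) :=
  (LipschitzWith.of_dist_le_mul (K := 1) fun z w => by
    simpa [dist_eq_norm] using norm_truncate_sub_le k z w).continuous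

/-- The fractional Sobolev inequality modulo constants. -/
theorem exists_eLpNorm_sub_const_le {s p q : ℝ} (hn : 0 < n) (hs : 0 < s) (hp : 1 ≤ p)
    (hq1 : 1 ≤ q) (hq : 1 / q = 1 / p - s / n) : ∃ C : ℝ, 0 < C ∧ ∀ w : Rn n → ℂ,
      LocallyIntegrable w → gagliardo s p w ≠ ⊤ → ∃ c : ℂ,
      eLpNorm (fun x => w x - c) (ENNReal.ofReal q) volume ≤
        ENNReal.ofReal C * gagliardo s p w ^ (1 / p) := by
  have hp0 : 0 < p := by linarith
  have hq0 : 0 < q := by linarith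
  obtain ⟨C, hC, h⟩ := poincare_sobolev_ball hn hs hp hq1 hq
  refine ⟨C, hC, fun w hw hgw => ?_⟩
  set f : ℕ → Rn n → ℂ := fun k x => truncate k (w x) with hf
  have hfm : ∀ k, AEStronglyMeasurable (f k) := fun k =>
    (continuous_truncate k).comp_aestronglyMeasurable hw.aestronglyMeasurable
  -- Radius `k + 1` rather than `k` gives `B 0` positive volume and puts every `x` with `‖x‖ ≤ k` in
  -- the open ball.
  set B : ℕ → Set (Rn n) := fun k => Metric.ball 0 (k + 1) with hB
  have hBm : ∀ k, MeasurableSet (B k) := fun k => Metric.isOpen_ball.measurableSet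
  set c : ℕ → ℂ := fun k => ⨍ z in B k, f k z with hc
  set X := ENNReal.ofReal C * gagliardo s p w ^ (1 / p) with hX
  have hXtop : X ≠ ⊤ := ENNReal.mul_ne_top ENNReal.ofReal_ne_top
    (ENNReal.rpow_ne_top_of_nonneg (by positivity) hgw)
  have hk : ∀ k, (∫⁻ y in B k, ‖f k y - c k‖ₑ ^ q) ^ (1 / q) ≤ X := by
    intro k
    refine (h (f k) (k + 1) (by positivity) (hfm k)
      ⟨2 * k, fun x => norm_truncate_le_two_mul (by positivity) _⟩).trans ?_
    rw [hX]
    gcongr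
    exact gagliardo_mono hp0.le fun x y => norm_truncate_sub_le _ _ _
  -- the averages are bounded
  have hBvol : volume (B 0) ≠ 0 := (Metric.measure_ball_pos _ _ (by positivity)).ne'
  have hBvol' : volume (B 0) ≠ ⊤ := measure_ball_lt_top.ne
  obtain ⟨D, hD⟩ : ∃ D : ℝ, ∀ k, ‖c k‖ ≤ D := by
    -- Integrate `|c k| ≤ |w| + |f k - c k|` over the fixed ball `B 0`. The first term is finite by
    -- local integrability, the second is bounded uniformly in `k` by Hölder and `hk`.
    set E := (∫⁻ y in B 0, ‖w y‖ₑ) + X * volume (B 0) ^ (1 - 1 / q) with hE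
    have hwB : IntegrableOn w (B 0) :=
      (hw.integrableOn_isCompact (isCompact_closedBall 0 _)).mono_set
        Metric.ball_subset_closedBall
    have hEtop : E ≠ ⊤ := by
      refine ENNReal.add_ne_top.2 ⟨hwB.2.ne, ENNReal.mul_ne_top hXtop ?_⟩
      refine ENNReal.rpow_ne_top_of_nonneg ?_ hBvol'
      rw [sub_nonneg, div_le_one hq0]
      exact hq1
    refine ⟨(E / volume (B 0)).toReal, fun k => ?_⟩
    rw [← ENNReal.ofReal_le_iff_le_toReal (ENNReal.div_ne_top hEtop hBvol), ofReal_norm,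
      ENNReal.le_div_iff_mul_le (Or.inl hBvol) (Or.inl hBvol'), ← setLIntegral_const]
    have h1 : ∫⁻ y in B 0, ‖f k y - c k‖ₑ ≤ X * volume (B 0) ^ (1 - 1 / q) := by
      have h2 := lintegral_enorm_le_rpow (volume.restrict (B 0)) hq1
        (h := fun y => f k y - c k) ((hfm k).sub aestronglyMeasurable_const).restrict
      rw [Measure.restrict_apply_univ] at h2
      refine h2.trans ?_
      gcongr
      refine le_trans ?_ (hk k)
      gcongr
      exact Metric.ball_subset_ball (by simp)
    calc ∫⁻ _ in B 0, ‖c k‖ₑ ≤ ∫⁻ y in B 0, (‖w y‖ₑ + ‖f k y - c k‖ₑ) := by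
          refine lintegral_mono fun y => ?_
          calc ‖c k‖ₑ = ‖f k y - (f k y - c k)‖ₑ := by rw [sub_sub_cancel]
            _ ≤ ‖f k y‖ₑ + ‖f k y - c k‖ₑ := enorm_sub_le
            _ ≤ _ := by
              gcongr
              exact enorm_le_iff_norm_le.2 (norm_truncate_le (by positivity) _)
      _ = (∫⁻ y in B 0, ‖w y‖ₑ) + ∫⁻ y in B 0, ‖f k y - c k‖ₑ :=
          lintegral_add_left' hwB.1.enorm _
      _ ≤ E := add_le_add le_rfl h1
  obtain ⟨c₀, -, φ, hφ, hlim⟩ := tendsto_subseq_of_bounded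
    (Metric.isBounded_closedBall (x := (0 : ℂ)) (r := D)) (x := c) (fun k => by simpa using hD k)
  refine ⟨c₀, ?_⟩
  -- Fatou along the subsequence: at each fixed `x` both the indicator and the truncation are
  -- eventually inactive, so the functions converge to `w x - c₀`.
  refine (Lp.eLpNorm_lim_le_liminf_eLpNorm
    (f := fun j => (B (φ j)).indicator fun x => f (φ j) x - c (φ j))
    (fun j => ((hfm _).sub aestronglyMeasurable_const).indicator (hBm _)) _
    (Filter.Eventually.of_forall fun x => ?_)).trans ?_
  · obtain ⟨N, hN⟩ := exists_nat_ge (max ‖x‖ ‖w x‖)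
    have h1 : ∀ᶠ j in Filter.atTop, w x - c (φ j) =
        (B (φ j)).indicator (fun x => f (φ j) x - c (φ j)) x := by
      filter_upwards [Filter.eventually_ge_atTop N] with j hj
      have hj' : (N : ℝ) ≤ φ j := by exact_mod_cast hj.trans (hφ.id_le j)
      have hx : x ∈ B (φ j) := by
        simp only [hB, mem_ball_zero_iff]
        linarith [le_max_left ‖x‖ ‖w x‖]
      rw [Set.indicator_of_mem hx]
      simp only [hf]
      rw [truncate_of_norm_le]
      linarith [le_max_right ‖x‖ ‖w x‖]
    exact Filter.Tendsto.congr' h1 (tendsto_const_nhds.sub hlim)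
  · refine Filter.liminf_le_of_le (by isBoundedDefault) fun b hb => ?_
    obtain ⟨j, hj⟩ := hb.exists
    refine hj.trans ?_
    rw [eLpNorm_indicator_eq_eLpNorm_restrict (hBm _),
      eLpNorm_eq_lintegral_rpow_enorm_toReal (by simpa using hq0) (by simp),
      ENNReal.toReal_ofReal hq0.le]
    exact hk _

/-! ### The off-diagonal measure and the difference function -/

theorem ae_fst_ne_snd (hn : 0 < n) : ∀ᵐ z : Rn n × Rn n, z.1 ≠ z.2 := by
  have : Nonempty (Fin n) := ⟨⟨0, hn⟩⟩
  have hm : MeasurableSet {z : Rn n × Rn n | ¬ z.1 ≠ z.2} := by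
    simpa using (isClosed_eq continuous_fst continuous_snd).measurableSet
  rw [ae_iff, Measure.volume_eq_prod, Measure.measure_prod_null hm]
  refine Filter.Eventually.of_forall fun x => ?_
  have : Prod.mk x ⁻¹' {z : Rn n × Rn n | ¬ z.1 ≠ z.2} = {x} := by ext y; simp [eq_comm]
  change volume (Prod.mk x ⁻¹' _) = 0
  rw [this]
  exact measure_singleton x

theorem measurable_offDiagDensity :
    Measurable fun z : Rn n × Rn n => ENNReal.ofReal ((‖z.1 - z.2‖ ^ n)⁻¹) := by
  fun_prop

/-- Where `|x-y| ≤ R`, the density `|x-y|^(-n)` is at least `R^(-n)`. Thus membership in `L^p_od`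
implies local `L^p` integrability for Lebesgue measure, even across the diagonal. -/
theorem restrict_le_smul_offDiagMeasure (hn : 0 < n) {K : Set (Rn n × Rn n)}
    (hK : MeasurableSet K) {R : ℝ} (hR : ∀ z ∈ K, ‖z.1 - z.2‖ ≤ R) :
    volume.restrict K ≤ ENNReal.ofReal (R ^ n) • offDiagMeasure n := by
  refine Measure.le_iff.2 fun A hA => ?_
  rw [Measure.restrict_apply hA, Measure.smul_apply, smul_eq_mul]
  calc volume (A ∩ K) = ∫⁻ _ in A ∩ K, 1 := (setLIntegral_one _).symm
    _ ≤ ∫⁻ z in A ∩ K, ENNReal.ofReal (R ^ n) * ENNReal.ofReal ((‖z.1 - z.2‖ ^ n)⁻¹) := by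
        refine lintegral_mono_ae ?_
        filter_upwards [ae_restrict_mem (hA.inter hK), ae_restrict_of_ae (ae_fst_ne_snd hn)]
          with z hz hne
        have hpos : 0 < ‖z.1 - z.2‖ := norm_pos_iff.2 (sub_ne_zero.2 hne)
        have hRz := hR z hz.2
        have hR0 : 0 ≤ R := hpos.le.trans hRz
        rw [← ENNReal.ofReal_mul (by positivity), ENNReal.one_le_ofReal, ← div_eq_mul_inv,
          one_le_div (by positivity)]
        gcongr
    _ = ENNReal.ofReal (R ^ n) * offDiagMeasure n (A ∩ K) := by
        rw [lintegral_const_mul' _ _ ENNReal.ofReal_ne_top, offDiagMeasure,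
          withDensity_apply _ (hA.inter hK)]
    _ ≤ _ := by gcongr; exact Set.inter_subset_left

/-- If `d_s u` is given by `F`, then `F(x,y) |x-y|^s` is `u(x) - u(y)`. -/
def difference (s : ℝ) (F : Rn n × Rn n → ℂ) (z : Rn n × Rn n) : ℂ :=
  ((‖z.1 - z.2‖ ^ s : ℝ) : ℂ) * F z

theorem locallyIntegrable_difference (hn : 0 < n) {s p : ℝ} (hs : 0 < s) (hp : 1 ≤ p)
    {F : Rn n × Rn n → ℂ} (hF : MemLpOd p F) : LocallyIntegrable (difference s F) := by
  rw [locallyIntegrable_iff]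
  intro K hK
  obtain ⟨R, hR⟩ := hK.exists_bound_of_continuousOn
    (f := fun z : Rn n × Rn n => z.1 - z.2) (by fun_prop)
  have hmem : MemLp F (ENNReal.ofReal p) (offDiagMeasure n) :=
    ⟨hF.aestronglyMeasurable.mono_ac (withDensity_absolutelyContinuous _ _), hF.norm_lt_top⟩
  have hle := restrict_le_smul_offDiagMeasure hn hK.measurableSet hR
  have hmem2 : MemLp F (ENNReal.ofReal p) (volume.restrict K) :=
    (hmem.smul_measure ENNReal.ofReal_ne_top).mono_measure hle
  have : IsFiniteMeasure (volume.restrict K) := ⟨by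
    rw [Measure.restrict_apply_univ]; exact hK.measure_lt_top⟩
  have hint : Integrable F (volume.restrict K) := hmem2.integrable (by simpa using hp)
  have hm : Measurable fun z : Rn n × Rn n => ((‖z.1 - z.2‖ ^ s : ℝ) : ℂ) := by fun_prop
  refine (hint.norm.const_mul (R ^ s)).mono' (hm.aestronglyMeasurable.mul hint.1) ?_
  filter_upwards [ae_restrict_mem hK.measurableSet] with z hz
  rw [difference, norm_mul, Complex.norm_real, Real.norm_of_nonneg (by positivity)]
  gcongr
  exact hR z hz

/-! ### Test functions supported off the diagonal -/

/-- The off-diagonal Schwartz function `|x-y|^(n+s) (g(x,y) - g(y,x)) / 2`. -/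
def weightedAntisymm (s : ℝ) (g : Rn n × Rn n → ℂ) (z : Rn n × Rn n) : ℂ :=
  ((‖z.1 - z.2‖ ^ (n + s) : ℝ) : ℂ) * (1 / 2 * (g z - g z.swap))

section Weighted

variable {g : Rn n × Rn n → ℂ}

/-- Vanishing near the diagonal settles two matters there: the lack of smoothness of `|x-y|^(n+s)`,
and the flatness demanded of off-diagonal Schwartz functions. -/
theorem weightedAntisymm_eventuallyEq_zero
    (hgd : ∀ z ∈ tsupport g, z.1 ≠ z.2) (s : ℝ) (x : Rn n) :
    weightedAntisymm s g =ᶠ[nhds (x, x)] fun _ => 0 := by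
  have h : (x, x) ∉ tsupport g := fun h => hgd _ h rfl
  have h1 : ∀ᶠ z in nhds ((x, x) : Rn n × Rn n), g z = 0 := notMem_tsupport_iff_eventuallyEq.1 h
  have h2 : ∀ᶠ z in nhds ((x, x) : Rn n × Rn n), g z.swap = 0 :=
    (continuous_swap.tendsto ((x, x) : Rn n × Rn n)).eventually h1
  filter_upwards [h1, h2] with z hz1 hz2
  simp [weightedAntisymm, hz1, hz2]

theorem contDiff_weightedAntisymm (hg : ContDiff ℝ ∞ g)
    (hgd : ∀ z ∈ tsupport g, z.1 ≠ z.2) (s : ℝ) : ContDiff ℝ ∞ (weightedAntisymm s g) := by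
  rw [contDiff_iff_contDiffAt]
  rintro ⟨x, y⟩
  rcases eq_or_ne x y with rfl | hxy
  · exact contDiffAt_const.congr_of_eventuallyEq (weightedAntisymm_eventuallyEq_zero hgd s x)
  · have h1 : ContDiffAt ℝ ∞ (fun z : Rn n × Rn n => ‖z.1 - z.2‖) (x, y) :=
      ContDiffAt.norm ℝ (by fun_prop) (sub_ne_zero.2 hxy)
    have h2 : ContDiffAt ℝ ∞ (fun z : Rn n × Rn n => ‖z.1 - z.2‖ ^ (n + s)) (x, y) :=
      h1.rpow_const_of_ne (norm_ne_zero_iff.2 (sub_ne_zero.2 hxy))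
    have h3 : ContDiff ℝ ∞ fun z : Rn n × Rn n => g z.swap :=
      hg.comp (contDiff_snd.prodMk contDiff_fst)
    exact (Complex.ofRealCLM.contDiff.contDiffAt.comp _ h2).mul
      (contDiffAt_const.mul (hg.contDiffAt.sub h3.contDiffAt))

theorem hasCompactSupport_weightedAntisymm (hgc : HasCompactSupport g) (s : ℝ) :
    HasCompactSupport (weightedAntisymm s g) := by
  have h : HasCompactSupport fun z : Rn n × Rn n => g z.swap :=
    hgc.comp_homeomorph (Homeomorph.prodComm (Rn n) (Rn n))
  exact HasCompactSupport.mul_left (HasCompactSupport.mul_left (hgc.sub h))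

/-- `weightedAntisymm` as an off-diagonal Schwartz function. -/
def weightedAntisymmOd (hg : ContDiff ℝ ∞ g) (hgc : HasCompactSupport g)
    (hgd : ∀ z ∈ tsupport g, z.1 ≠ z.2) (s : ℝ) : offDiagSchwartz n :=
  ⟨(hasCompactSupport_weightedAntisymm hgc s).toSchwartzMap (contDiff_weightedAntisymm hg hgd s), by
    refine ⟨fun x y => ?_, fun k z => ?_⟩
    · change weightedAntisymm s g (x, y) = -weightedAntisymm s g (y, x)
      simp only [weightedAntisymm, Prod.swap_prod_mk, norm_sub_rev x y]
      ring
    · change iteratedFDeriv ℝ k (weightedAntisymm s g) (z, z) = 0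
      rw [((weightedAntisymm_eventuallyEq_zero hgd s z).iteratedFDeriv ℝ k).eq_of_nhds,
        iteratedFDeriv_fun_zero]
      rfl⟩

theorem coe_weightedAntisymmOd (hg : ContDiff ℝ ∞ g) (hgc : HasCompactSupport g)
    (hgd : ∀ z ∈ tsupport g, z.1 ≠ z.2) (s : ℝ) (z : Rn n × Rn n) :
    (weightedAntisymmOd hg hgc hgd s).1 z = weightedAntisymm s g z := rfl

/-- The weight cancels the kernel `|x-y|^(-(n+s))`, and the factor `1/2` cancels the `2` in the
divergence. -/
theorem fracDiv_weightedAntisymmOd (hn : 0 < n) (hg : ContDiff ℝ ∞ g) (hgc : HasCompactSupport g)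
    (hgd : ∀ z ∈ tsupport g, z.1 ≠ z.2) (s : ℝ) (x : Rn n) :
    fracDiv s (weightedAntisymmOd hg hgc hgd s) x = ∫ y, (g (x, y) - g (y, x)) := by
  have : Nonempty (Fin n) := ⟨⟨0, hn⟩⟩
  rw [fracDiv_apply]
  refine integral_congr_ae ?_
  have : ∀ᵐ y : Rn n, y ≠ x := by simp [ae_iff]
  filter_upwards [this] with y hy
  have hpos : 0 < ‖x - y‖ := norm_pos_iff.2 (sub_ne_zero.2 hy.symm)
  rw [coe_weightedAntisymmOd, weightedAntisymm, Complex.real_smul]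
  simp only [Prod.swap_prod_mk]
  rw [Real.rpow_neg hpos.le, Complex.ofReal_inv]
  have : ((‖x - y‖ ^ (n + s) : ℝ) : ℂ) ≠ 0 := by
    exact_mod_cast (Real.rpow_pos_of_pos hpos _).ne'
  field_simp

/-- This turns the hypothesis on `d_s u` into a pairing with a locally integrable function. The
antisymmetrization of `g` disappears because `difference s F` is itself antisymmetric. -/
theorem apply_fracDiv_weightedAntisymmOd (hn : 0 < n) (hg : ContDiff ℝ ∞ g)
    (hgc : HasCompactSupport g) (hgd : ∀ z ∈ tsupport g, z.1 ≠ z.2) {s p : ℝ} (hs : 0 < s)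
    (hp : 1 ≤ p) {u : 𝓢'(Rn n, ℂ)} {F : Rn n × Rn n → ℂ} (hF : MemLpOd p F)
    (hu : IsGivenBy (fracGrad s u) F) :
    u (fracDiv s (weightedAntisymmOd hg hgc hgd s)) = ∫ z, difference s F z * g z := by
  have h1 : u (fracDiv s (weightedAntisymmOd hg hgc hgd s)) = _ :=
    hu (weightedAntisymmOd hg hgc hgd s)
  rw [h1, offDiagMeasure, integral_withDensity_eq_integral_toReal_smul measurable_offDiagDensity
    (Filter.Eventually.of_forall fun z => ENNReal.ofReal_lt_top)]
  have hH := locallyIntegrable_difference hn hs hp hF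
  have hi (f : Rn n × Rn n → ℂ) (hf : Continuous f) (hfc : HasCompactSupport f) :
      Integrable fun z => difference s F z * f z := by
    have := hH.integrable_smul_right_of_hasCompactSupport hf hfc
    simpa using this
  have hsw : Continuous fun z : Rn n × Rn n => g z.swap := hg.continuous.comp continuous_swap
  have hswc : HasCompactSupport fun z : Rn n × Rn n => g z.swap :=
    hgc.comp_homeomorph (Homeomorph.prodComm (Rn n) (Rn n))
  have h2 : ∫ z, difference s F z * g z.swap = -∫ z, difference s F z * g z := by
    have e : ∫ z : Rn n × Rn n, difference s F z.swap * g z = ∫ z, difference s F z * g z.swap :=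
      integral_prod_swap (μ := (volume : Measure (Rn n))) (ν := (volume : Measure (Rn n)))
        (fun z => difference s F z * g z.swap)
    rw [← e, ← integral_neg]
    refine integral_congr_ae ?_
    filter_upwards [hF.antisymm] with z hz
    simp only [difference, Prod.swap, hz, norm_sub_rev z.2 z.1]
    ring
  have h3 : ∫ z, difference s F z * g z =
      ∫ z, (1 / 2 * (difference s F z * g z) - 1 / 2 * (difference s F z * g z.swap)) := by
    rw [integral_sub ((hi _ hg.continuous hgc).const_mul _) ((hi _ hsw hswc).const_mul _),
      integral_const_mul, integral_const_mul, h2]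
    ring
  rw [h3]
  refine integral_congr_ae ?_
  filter_upwards [ae_fst_ne_snd hn] with z hz
  have hpos : 0 < ‖z.1 - z.2‖ := norm_pos_iff.2 (sub_ne_zero.2 hz)
  rw [coe_weightedAntisymmOd, weightedAntisymm, difference, ENNReal.toReal_ofReal (by positivity),
    Complex.real_smul, Real.rpow_add hpos, Real.rpow_natCast]
  have : ((‖z.1 - z.2‖ : ℝ) : ℂ) ≠ 0 := by exact_mod_cast hpos.ne'
  push_cast
  field_simp

end Weighted

/-! ### Representation of the distribution by a function -/

theorem locallyIntegrable_comp_fst {w : Rn n → ℂ} (hw : LocallyIntegrable w) :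
    LocallyIntegrable fun z : Rn n × Rn n => w z.1 := by
  rw [locallyIntegrable_iff]
  intro K hK
  have h1 := hK.image continuous_fst
  have h2 := hK.image continuous_snd
  have : IsFiniteMeasure (volume.restrict (Prod.snd '' K)) :=
    ⟨by rw [Measure.restrict_apply_univ]; exact h2.measure_lt_top⟩
  have h := (hw.integrableOn_isCompact h1).comp_fst (volume.restrict (Prod.snd '' K))
  rw [Measure.prod_restrict] at h
  exact IntegrableOn.mono_set h fun z hz =>
    ⟨Set.mem_image_of_mem _ hz, Set.mem_image_of_mem _ hz⟩

theorem locallyIntegrable_comp_snd {w : Rn n → ℂ} (hw : LocallyIntegrable w) :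
    LocallyIntegrable fun z : Rn n × Rn n => w z.2 := by
  rw [locallyIntegrable_iff]
  intro K hK
  have h1 := hK.image continuous_fst
  have h2 := hK.image continuous_snd
  have : IsFiniteMeasure (volume.restrict (Prod.fst '' K)) :=
    ⟨by rw [Measure.restrict_apply_univ]; exact h1.measure_lt_top⟩
  have h := (hw.integrableOn_isCompact h2).comp_snd (volume.restrict (Prod.fst '' K))
  rw [Measure.prod_restrict] at h
  exact IntegrableOn.mono_set h fun z hz =>
    ⟨Set.mem_image_of_mem _ hz, Set.mem_image_of_mem _ hz⟩

theorem locallyIntegrable_integral_mul {H : Rn n × Rn n → ℂ} (hH : LocallyIntegrable H)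
    {χ : Rn n → ℂ} (hχ : Continuous χ) (hχc : HasCompactSupport χ) :
    LocallyIntegrable fun x => ∫ y, H (x, y) * χ y := by
  rw [locallyIntegrable_iff]
  intro K hK
  have h1 : IntegrableOn (fun z : Rn n × Rn n => H z * χ z.2) (K ×ˢ tsupport χ) :=
    (hH.integrableOn_isCompact (hK.prod hχc.isCompact)).mul_continuousOn
      (by fun_prop) (hK.prod hχc.isCompact)
  have h2 : IntegrableOn (fun z : Rn n × Rn n => H z * χ z.2) (K ×ˢ Set.univ) := by
    refine h1.of_forall_sdiff_eq_zero (hK.measurableSet.prod MeasurableSet.univ) ?_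
    rintro z ⟨hz, hz'⟩
    have : z.2 ∉ tsupport χ := fun h => hz' ⟨hz.1, h⟩
    rw [image_eq_zero_of_notMem_tsupport this, mul_zero]
  rw [IntegrableOn, Measure.volume_eq_prod, ← Measure.prod_restrict, Measure.restrict_univ] at h2
  exact h2.integral_prod_left

section Representation

variable {s p : ℝ} {u : 𝓢'(Rn n, ℂ)} {F : Rn n × Rn n → ℂ}

/-- Away from the support of `χ`, the distribution `u` is given by
`x ↦ ⟨u, χ⟩ + ∫ F(x,y) |x-y|^s χ(y) dy`. -/
theorem apply_eq_integral_of_disjoint (hn : 0 < n) (hs : 0 < s) (hp : 1 ≤ p)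
    (hF : MemLpOd p F) (hu : IsGivenBy (fracGrad s u) F) (φ χ : 𝓢(Rn n, ℂ))
    (hφ : HasCompactSupport φ) (hχ : HasCompactSupport χ) (hχ1 : ∫ x, χ x = 1)
    (hd : Disjoint (tsupport φ) (tsupport χ)) :
    u φ = ∫ x, (u χ + ∫ y, difference s F (x, y) * χ y) * φ x := by
  -- Disjointness of the supports keeps the support of `φ ⊗ χ` off the diagonal. As `∫ χ = 1`, the
  -- resulting divergence is `φ - (∫ φ) χ`.
  set g : Rn n × Rn n → ℂ := fun z => φ z.1 * χ z.2 with hg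
  have hgs : ContDiff ℝ ∞ g :=
    ((φ.smooth ⊤).comp contDiff_fst).mul ((χ.smooth ⊤).comp contDiff_snd)
  have hsub : tsupport g ⊆ tsupport φ ×ˢ tsupport χ := by
    refine closure_minimal (fun z hz => ?_) ((isClosed_tsupport _).prod (isClosed_tsupport _))
    exact ⟨subset_tsupport _ (left_ne_zero_of_mul hz), subset_tsupport _ (right_ne_zero_of_mul hz)⟩
  have hgc : HasCompactSupport g :=
    (hφ.isCompact.prod hχ.isCompact).of_isClosed_subset (isClosed_tsupport _) hsub
  have hgd : ∀ z ∈ tsupport g, z.1 ≠ z.2 := fun z hz h =>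
    Set.disjoint_left.1 hd (hsub hz).1 (h ▸ (hsub hz).2)
  have h1 := apply_fracDiv_weightedAntisymmOd hn hgs hgc hgd hs hp hF hu
  have h2 : fracDiv s (weightedAntisymmOd hgs hgc hgd s) = φ - (∫ x, φ x) • χ := by
    ext x
    rw [fracDiv_weightedAntisymmOd hn]
    simp only [hg]
    rw [integral_sub (χ.integrable.const_mul _) (φ.integrable.mul_const _), integral_const_mul,
      integral_mul_const, hχ1]
    simp
  have hH := locallyIntegrable_difference hn hs hp hF
  have hi : Integrable fun z => difference s F z * g z := by
    have := hH.integrable_smul_right_of_hasCompactSupport hgs.continuous hgc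
    simpa using this
  have h3 : ∫ z, difference s F z * g z =
      ∫ x, (∫ y, difference s F (x, y) * χ y) * φ x := by
    rw [Measure.volume_eq_prod, integral_prod _ (by rwa [← Measure.volume_eq_prod])]
    refine integral_congr_ae (Filter.Eventually.of_forall fun x => ?_)
    simp only [hg]
    rw [← integral_mul_const]
    congr 1; ext y; ring
  have hi2 : Integrable fun x => (∫ y, difference s F (x, y) * χ y) * φ x := by
    have := (locallyIntegrable_integral_mul hH χ.continuous
      hχ).integrable_smul_right_of_hasCompactSupport φ.continuous hφ
    simpa using this
  rw [h2, h3, map_sub, map_smul, smul_eq_mul] at h1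
  simp only [add_mul]
  rw [integral_add (φ.integrable.const_mul _) hi2, integral_const_mul, ← h1]
  ring

theorem exists_bump (c : Rn n) {r R : ℝ} (hr : 0 < r) (hR : r < R) :
    ∃ θ : Rn n → ℂ, ContDiff ℝ ∞ θ ∧ tsupport θ = Metric.closedBall c R ∧
      ∀ x ∈ Metric.closedBall c r, θ x = 1 := by
  let b : ContDiffBump c := ⟨r, R, hr, hR⟩
  refine ⟨fun x => (b x : ℂ), Complex.ofRealCLM.contDiff.comp b.contDiff, ?_, fun x hx => ?_⟩
  · rw [← b.tsupport_eq]
    simp [tsupport, Function.support]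
  · simpa using b.one_of_mem_closedBall hx

theorem exists_normed_bump (c : Rn n) : ∃ χ : 𝓢(Rn n, ℂ), HasCompactSupport χ ∧
    tsupport χ = Metric.closedBall c 1 ∧ ∫ x, χ x = 1 := by
  let b : ContDiffBump c := ⟨1 / 2, 1, by norm_num, by norm_num⟩
  have hd : ContDiff ℝ ∞ fun x => (b.normed volume x : ℂ) :=
    Complex.ofRealCLM.contDiff.comp b.contDiff_normed
  have ht : tsupport (fun x => (b.normed volume x : ℂ)) = Metric.closedBall c 1 := by
    rw [← b.tsupport_normed_eq (μ := volume)]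
    simp [tsupport, Function.support]
  have hc : HasCompactSupport fun x => (b.normed volume x : ℂ) := by
    rw [HasCompactSupport, ht]; exact isCompact_closedBall _ _
  refine ⟨hc.toSchwartzMap hd, hc, ht, ?_⟩
  change ∫ x, (b.normed volume x : ℂ) = 1
  rw [integral_complex_ofReal, b.integral_normed, Complex.ofReal_one]

/-- A distribution whose fractional gradient belongs to `L^p_od` is given by a locally integrable
function. -/
theorem exists_locallyIntegrable (hn : 0 < n) (hs : 0 < s) (hp : 1 ≤ p)
    (hF : MemLpOd p F) (hu : IsGivenBy (fracGrad s u) F) :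
    ∃ w : Rn n → ℂ, LocallyIntegrable w ∧
      ∀ φ : 𝓢(Rn n, ℂ), HasCompactSupport φ → u φ = ∫ x, w x * φ x := by
  -- The radii separate supports: `(1 - θ) φ` lives outside the ball of radius 2, hence away from
  -- `χ₁` in the unit ball, and `θ φ` lives in the ball of radius 3, away from `χ₂` in the unit ball
  -- about a point of norm 10. The representing function is `(1 - θ) w₁ + θ w₂`.
  obtain ⟨θ, hθ, hθs, hθ1⟩ := exists_bump (0 : Rn n) two_pos (by norm_num : (2 : ℝ) < 3)
  obtain ⟨χ₁, hχ₁, hχ₁s, hχ₁i⟩ := exists_normed_bump (0 : Rn n)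
  set e : Rn n := EuclideanSpace.single ⟨0, hn⟩ 10 with he
  have hen : ‖e‖ = 10 := by simp [he]
  obtain ⟨χ₂, hχ₂, hχ₂s, hχ₂i⟩ := exists_normed_bump e
  have hH := locallyIntegrable_difference hn hs hp hF
  set w₁ : Rn n → ℂ := fun x => u χ₁ + ∫ y, difference s F (x, y) * χ₁ y
  set w₂ : Rn n → ℂ := fun x => u χ₂ + ∫ y, difference s F (x, y) * χ₂ y
  have hw₁ : LocallyIntegrable w₁ :=
    (locallyIntegrable_const _).add (locallyIntegrable_integral_mul hH χ₁.continuous hχ₁)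
  have hw₂ : LocallyIntegrable w₂ :=
    (locallyIntegrable_const _).add (locallyIntegrable_integral_mul hH χ₂.continuous hχ₂)
  have hθ' : ContDiff ℝ ∞ fun x => 1 - θ x := contDiff_const.sub hθ
  have hmul (f v : Rn n → ℂ) (hf : Continuous f) (hv : LocallyIntegrable v) :
      LocallyIntegrable fun x => f x * v x := by
    rw [locallyIntegrable_iff] at hv ⊢
    exact fun K hK => (hv K hK).continuousOn_mul hf.continuousOn hK
  have hm₁ := hmul _ _ hθ'.continuous hw₁
  have hm₂ := hmul _ _ hθ.continuous hw₂
  refine ⟨_, hm₁.add hm₂, fun φ hφ => ?_⟩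
  have hc₁ : HasCompactSupport fun x => (1 - θ x) * φ x := hφ.mul_left
  have hc₂ : HasCompactSupport fun x => θ x * φ x := hφ.mul_left
  set φ₁ := hc₁.toSchwartzMap (hθ'.mul (φ.smooth ⊤)) with hφ₁
  set φ₂ := hc₂.toSchwartzMap (hθ.mul (φ.smooth ⊤)) with hφ₂
  have hφ₁a (x) : φ₁ x = (1 - θ x) * φ x := rfl
  have hφ₂a (x) : φ₂ x = θ x * φ x := rfl
  have hsum : φ = φ₁ + φ₂ := by ext x; rw [add_apply, hφ₁a, hφ₂a]; ring
  have hd₁ : Disjoint (tsupport φ₁) (tsupport χ₁) := by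
    rw [hχ₁s]
    have : tsupport φ₁ ⊆ (Metric.ball (0 : Rn n) 2)ᶜ := by
      refine closure_minimal (fun x hx hx' => hx ?_) Metric.isOpen_ball.isClosed_compl
      rw [hφ₁a, hθ1 x (Metric.ball_subset_closedBall hx'), sub_self, zero_mul]
    refine Set.disjoint_left.2 fun x hx hx' => this hx ?_
    exact Metric.closedBall_subset_ball (by norm_num) hx'
  have hd₂ : Disjoint (tsupport φ₂) (tsupport χ₂) := by
    rw [hχ₂s]
    have : tsupport φ₂ ⊆ tsupport θ := closure_mono fun x hx => left_ne_zero_of_mul hx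
    refine Disjoint.mono_left (this.trans hθs.subset) (Metric.closedBall_disjoint_closedBall ?_)
    rw [dist_zero_left, hen]; norm_num
  have h₁ := apply_eq_integral_of_disjoint hn hs hp hF hu φ₁ χ₁ hc₁ hχ₁ hχ₁i hd₁
  have h₂ := apply_eq_integral_of_disjoint hn hs hp hF hu φ₂ χ₂ hc₂ hχ₂ hχ₂i hd₂
  have hi₁ : Integrable fun x => (1 - θ x) * w₁ x * φ x := by
    simpa using hm₁.integrable_smul_right_of_hasCompactSupport φ.continuous hφ
  have hi₂ : Integrable fun x => θ x * w₂ x * φ x := by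
    simpa using hm₂.integrable_smul_right_of_hasCompactSupport φ.continuous hφ
  have e₁ : u φ₁ = ∫ x, (1 - θ x) * w₁ x * φ x := by
    rw [h₁]; congr 1; ext x; rw [hφ₁a]; ring
  have e₂ : u φ₂ = ∫ x, θ x * w₂ x * φ x := by
    rw [h₂]; congr 1; ext x; rw [hφ₂a]; ring
  rw [hsum, map_add, e₁, e₂, ← integral_add hi₁ hi₂, ← hsum]
  congr 1; ext x; simp only [Pi.add_apply]; ring

/-- For a test function `G` supported off the diagonal, the value of `u` at `∫ (G(x,y) - G(y,x)) dy`
is computed twice: through `F`, and through `w` with Fubini. The fundamental lemma on the complement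
of the diagonal is enough, the diagonal being null. -/
theorem ae_difference_eq (hn : 0 < n) (hs : 0 < s) (hp : 1 ≤ p)
    (hF : MemLpOd p F) (hu : IsGivenBy (fracGrad s u) F) {w : Rn n → ℂ}
    (hw : LocallyIntegrable w)
    (huw : ∀ φ : 𝓢(Rn n, ℂ), HasCompactSupport φ → u φ = ∫ x, w x * φ x) :
    ∀ᵐ z : Rn n × Rn n, w z.1 - w z.2 = difference s F z := by
  have hH := locallyIntegrable_difference hn hs hp hF
  have hw1 := locallyIntegrable_comp_fst hw
  have hw2 := locallyIntegrable_comp_snd hw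
  have hopen : IsOpen {z : Rn n × Rn n | z.1 ≠ z.2} := isOpen_ne_fun continuous_fst continuous_snd
  have hloc := (hw1.sub hw2).sub hH
  have key := hopen.ae_eq_zero_of_integral_contDiff_smul_eq_zero (hloc.locallyIntegrableOn _) ?_
  · filter_upwards [key, ae_fst_ne_snd hn] with z hz hne
    exact sub_eq_zero.1 (hz hne)
  intro g hg hgc hgd
  set G : Rn n × Rn n → ℂ := fun z => (g z : ℂ) with hG
  have hGs : ContDiff ℝ ∞ G := Complex.ofRealCLM.contDiff.comp hg
  have hts : tsupport G = tsupport g := by simp [hG, tsupport, Function.support]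
  have hGc : HasCompactSupport G := by rw [HasCompactSupport, hts]; exact hgc
  have hGd : ∀ z ∈ tsupport G, z.1 ≠ z.2 := fun z hz => hgd (hts ▸ hz)
  have hi (f : Rn n × Rn n → ℂ) (hf : LocallyIntegrable f) : Integrable fun z => f z * G z := by
    simpa using hf.integrable_smul_right_of_hasCompactSupport hGs.continuous hGc
  have h1 := apply_fracDiv_weightedAntisymmOd hn hGs hGc hGd hs hp hF hu
  set φ := fracDiv s (weightedAntisymmOd hGs hGc hGd s) with hφ
  have hφa (x) : φ x = ∫ y, (G (x, y) - G (y, x)) := fracDiv_weightedAntisymmOd hn hGs hGc hGd s x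
  -- Compact support is needed for `huw`: `φ` vanishes off the two projections of the support of
  -- `G`.
  have hφc : HasCompactSupport φ := by
    refine HasCompactSupport.intro
      ((hGc.isCompact.image continuous_fst).union (hGc.isCompact.image continuous_snd))
      fun x hx => ?_
    rw [hφa]
    have h1 (y) : G (x, y) = 0 := image_eq_zero_of_notMem_tsupport fun h =>
      hx (Or.inl ⟨_, h, rfl⟩)
    have h2 (y) : G (y, x) = 0 := image_eq_zero_of_notMem_tsupport fun h =>
      hx (Or.inr ⟨_, h, rfl⟩)
    simp [h1, h2]
  have hslice1 (x : Rn n) : Integrable fun y => G (x, y) := by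
    refine (hGs.continuous.comp (Continuous.prodMk_right x)).integrable_of_hasCompactSupport ?_
    refine HasCompactSupport.intro (hGc.isCompact.image continuous_snd) fun y hy => ?_
    change G _ = 0
    exact image_eq_zero_of_notMem_tsupport fun h => hy ⟨(x, y), h, rfl⟩
  have hslice2 (x : Rn n) : Integrable fun y => G (y, x) := by
    refine (hGs.continuous.comp (Continuous.prodMk_left x)).integrable_of_hasCompactSupport ?_
    refine HasCompactSupport.intro (hGc.isCompact.image continuous_fst) fun y hy => ?_
    change G _ = 0
    exact image_eq_zero_of_notMem_tsupport fun h => hy ⟨(y, x), h, rfl⟩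
  have hI1 := hi _ hw1
  have hI2 := hi _ hw2
  have hI2' : Integrable fun z : Rn n × Rn n => w z.1 * G z.swap := hI2.swap
  have e1 : ∫ z : Rn n × Rn n, w z.1 * G z = ∫ x, w x * ∫ y, G (x, y) := by
    rw [Measure.volume_eq_prod, integral_prod _ (by rwa [← Measure.volume_eq_prod])]
    simp only [integral_const_mul]
  have e2 : ∫ z : Rn n × Rn n, w z.2 * G z = ∫ x, w x * ∫ y, G (y, x) := by
    have : ∫ z : Rn n × Rn n, w z.1 * G z.swap = ∫ z : Rn n × Rn n, w z.2 * G z :=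
      integral_prod_swap (μ := (volume : Measure (Rn n))) (ν := (volume : Measure (Rn n)))
        (fun z => w z.2 * G z)
    rw [← this, Measure.volume_eq_prod, integral_prod _ (by rwa [← Measure.volume_eq_prod])]
    simp only [integral_const_mul, Prod.swap_prod_mk]
  have i1 : Integrable fun x => w x * ∫ y, G (x, y) := by
    have := Integrable.integral_prod_left (μ := (volume : Measure (Rn n)))
      (ν := (volume : Measure (Rn n))) hI1
    simpa only [integral_const_mul] using this
  have i2 : Integrable fun x => w x * ∫ y, G (y, x) := by
    have := Integrable.integral_prod_left (μ := (volume : Measure (Rn n)))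
      (ν := (volume : Measure (Rn n))) hI2'
    simpa only [integral_const_mul, Prod.swap_prod_mk] using this
  have h2 : ∫ z : Rn n × Rn n, (w z.1 * G z - w z.2 * G z) = ∫ z, difference s F z * G z := by
    rw [← h1, huw φ hφc, integral_sub hI1 hI2, e1, e2, ← integral_sub i1 i2]
    congr 1; ext x
    rw [hφa, integral_sub (hslice1 x) (hslice2 x), mul_sub]
  have hI12 : Integrable fun z : Rn n × Rn n => w z.1 * G z - w z.2 * G z := hI1.sub hI2
  rw [← sub_eq_zero, ← integral_sub hI12 (hi _ hH)] at h2
  rw [← h2]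
  congr 1; ext z
  simp only [hG, Complex.real_smul, Pi.sub_apply]
  ring

/-- Against real test functions, the imaginary part of the pairing is the pairing with `Im w`, so
the fundamental lemma applies to `Im w`. -/
theorem ae_im_eq_zero (hur : IsRealDistribution u) {w : Rn n → ℂ} (hw : LocallyIntegrable w)
    (huw : ∀ φ : 𝓢(Rn n, ℂ), HasCompactSupport φ → u φ = ∫ x, w x * φ x) :
    ∀ᵐ x, (w x).im = 0 := by
  have him : LocallyIntegrable fun x => (w x).im := by
    rw [locallyIntegrable_iff] at hw ⊢
    exact fun K hK => (hw K hK).im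
  refine ae_eq_zero_of_integral_contDiff_smul_eq_zero him fun g hg hgc => ?_
  have hGs : ContDiff ℝ ∞ fun x => (g x : ℂ) := Complex.ofRealCLM.contDiff.comp hg
  have hGc : HasCompactSupport fun x => (g x : ℂ) := hgc.comp_left (g := Complex.ofReal) rfl
  set ψ : 𝓢(Rn n, ℂ) := hGc.toSchwartzMap hGs with hψ
  have hψa (x) : ψ x = (g x : ℂ) := rfl
  have h1 := hur ψ fun x => by rw [hψa, Complex.ofReal_im]
  rw [huw ψ hGc] at h1
  have hi : Integrable fun x => w x * ψ x := by
    simpa using hw.integrable_smul_right_of_hasCompactSupport ψ.continuous hGc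
  have h2 := Complex.imCLM.integral_comp_comm hi
  rw [Complex.imCLM_apply, h1] at h2
  simpa [hψa, mul_comm] using h2

end Representation

/-! ### Density, equality of the norms, and reality of the constant -/

/-- Compactly supported functions are dense in the Schwartz space. -/
theorem exists_tendsto_hasCompactSupport (φ : 𝓢(Rn n, ℂ)) :
    ∃ ψ : ℕ → 𝓢(Rn n, ℂ), (∀ k, HasCompactSupport (ψ k)) ∧
      Filter.Tendsto ψ Filter.atTop (nhds φ) := by
  obtain ⟨θ, hθ, hθs, hθ1⟩ := exists_bump (0 : Rn n) one_pos one_lt_two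
  have hθc : HasCompactSupport θ := by
    rw [HasCompactSupport, hθs]; exact isCompact_closedBall _ _
  set m : Rn n → ℂ := fun x => 1 - θ x with hm
  have hms : ContDiff ℝ ∞ m := contDiff_const.sub hθ
  have hbd : ∀ i : ℕ, ∃ C : ℝ, ∀ x, ‖iteratedFDeriv ℝ i m x‖ ≤ C := by
    intro i
    have hi : ((i : ℕ) : WithTop ℕ∞) ≤ ((⊤ : ℕ∞) : WithTop ℕ∞) := by exact_mod_cast le_top
    obtain ⟨C, hC⟩ := (hθc.iteratedFDeriv (𝕜 := ℝ) i).exists_bound_of_continuous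
      (hθ.continuous_iteratedFDeriv hi)
    refine ⟨1 + C, fun x => ?_⟩
    have e : m = (fun _ => (1 : ℂ)) - θ := rfl
    rw [e, iteratedFDeriv_sub_apply contDiffAt_const (hθ.of_le hi).contDiffAt]
    refine (norm_sub_le _ _).trans (add_le_add ?_ (hC x))
    rcases i with _ | i
    · simp
    · rw [iteratedFDeriv_succ_const]; simp
  choose C hC using hbd
  have hC0 (i) : 0 ≤ C i := (norm_nonneg _).trans (hC i 0)
  set a : ℕ → ℝ := fun k => ((k : ℝ) + 1)⁻¹ with ha
  have ha0 (k) : 0 < a k := by positivity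
  have ha1 (k) : a k ≤ 1 := inv_le_one_of_one_le₀ (by simp)
  have hθa (k) : ContDiff ℝ ∞ fun x : Rn n => θ (a k • x) := hθ.comp (contDiff_const_smul _)
  have hma (k) : ContDiff ℝ ∞ fun x : Rn n => m (a k • x) := hms.comp (contDiff_const_smul _)
  have hc (k) : HasCompactSupport fun x : Rn n => θ (a k • x) * φ x :=
    (hθc.comp_homeomorph (Homeomorph.smulOfNeZero (a k) (ha0 k).ne')).mul_right
  set ψ : ℕ → 𝓢(Rn n, ℂ) := fun k => (hc k).toSchwartzMap ((hθa k).mul (φ.smooth ⊤)) with hψ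
  have hψa (k) (x) : ψ k x = θ (a k • x) * φ x := rfl
  refine ⟨ψ, hc, ?_⟩
  rw [(schwartz_withSeminorms ℝ (Rn n) ℂ).tendsto_nhds]
  rintro ⟨l, j⟩ ε hε
  set M : ℝ := ∑ i ∈ Finset.range (j + 1),
    (j.choose i : ℝ) * C i * SchwartzMap.seminorm ℝ (l + 1) (j - i) φ with hM
  have hM0 : 0 ≤ M := Finset.sum_nonneg fun i _ =>
    mul_nonneg (mul_nonneg (by positivity) (hC0 i)) (apply_nonneg _ _)
  have key (k : ℕ) : SchwartzMap.seminorm ℝ l j (ψ k - φ) ≤ a k * M := by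
    refine SchwartzMap.seminorm_le_bound ℝ l j _ (mul_nonneg (ha0 k).le hM0) fun x => ?_
    have e : (⇑(ψ k - φ) : Rn n → ℂ) = -fun x => m (a k • x) * φ x := by
      ext y
      simp only [sub_apply, hψa, hm, Pi.neg_apply]
      ring
    rw [e, iteratedFDeriv_neg_apply, norm_neg]
    -- The error `m (a k • x) * φ x` vanishes where `‖a k • x‖ < 1`. Elsewhere `1 ≤ a k * ‖x‖`, so
    -- one more power of `‖x‖`, absorbed by the decay of `φ`, buys the small factor `a k`.
    -- Derivatives falling on the dilated `m` cost at most `C i` since `a k ≤ 1`.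
    rcases lt_or_ge ‖a k • x‖ 1 with h | h
    · have h0 : (fun x : Rn n => m (a k • x) * φ x) =ᶠ[nhds x] fun _ => 0 := by
        have hopen : IsOpen {y : Rn n | ‖a k • y‖ < 1} :=
          isOpen_lt (by fun_prop) continuous_const
        filter_upwards [hopen.mem_nhds h] with y hy
        have : θ (a k • y) = 1 := hθ1 _ (by simpa using (show ‖a k • y‖ < 1 from hy).le)
        simp only [hm, this, sub_self, zero_mul]
      rw [(h0.iteratedFDeriv ℝ j).eq_of_nhds, iteratedFDeriv_fun_zero]
      simpa using mul_nonneg (ha0 k).le hM0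
    · have hx : 1 ≤ a k * ‖x‖ := by
        rwa [norm_smul, Real.norm_of_nonneg (ha0 k).le] at h
      have hj : ((j : ℕ) : WithTop ℕ∞) ≤ ((⊤ : ℕ∞) : WithTop ℕ∞) := by exact_mod_cast le_top
      calc ‖x‖ ^ l * ‖iteratedFDeriv ℝ j (fun x => m (a k • x) * φ x) x‖
          ≤ ‖x‖ ^ l * ∑ i ∈ Finset.range (j + 1), (j.choose i : ℝ) *
            ‖iteratedFDeriv ℝ i (fun x => m (a k • x)) x‖ * ‖iteratedFDeriv ℝ (j - i) φ x‖ := by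
            gcongr
            exact norm_iteratedFDeriv_mul_le (hma k) (φ.smooth ⊤) x hj
        _ ≤ (a k * ‖x‖) * (‖x‖ ^ l * ∑ i ∈ Finset.range (j + 1), (j.choose i : ℝ) *
            C i * ‖iteratedFDeriv ℝ (j - i) φ x‖) := by
            refine le_trans ?_ (le_mul_of_one_le_left (mul_nonneg (by positivity)
              (Finset.sum_nonneg fun i _ => mul_nonneg (mul_nonneg (by positivity) (hC0 i))
                (norm_nonneg _))) hx)
            gcongr with i hi
            have hi' : ((i : ℕ) : WithTop ℕ∞) ≤ ((⊤ : ℕ∞) : WithTop ℕ∞) := by exact_mod_cast le_top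
            rw [iteratedFDeriv_comp_const_smul (a k) (hms.of_le hi'), norm_smul]
            calc ‖a k ^ i‖ * ‖iteratedFDeriv ℝ i m (a k • x)‖ ≤ 1 * C i := by
                  gcongr
                  · rw [norm_pow, Real.norm_of_nonneg (ha0 k).le]
                    exact pow_le_one₀ (ha0 k).le (ha1 k)
                  · exact hC _ _
              _ = C i := one_mul _
        _ = a k * ∑ i ∈ Finset.range (j + 1), (j.choose i : ℝ) *
            C i * (‖x‖ ^ (l + 1) * ‖iteratedFDeriv ℝ (j - i) φ x‖) := by
            rw [mul_assoc, ← mul_assoc ‖x‖, ← pow_succ', Finset.mul_sum]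
            congr 1
            exact Finset.sum_congr rfl fun i _ => by ring
        _ ≤ a k * M := by
            rw [hM]
            gcongr with i hi
            · exact mul_nonneg (by positivity) (hC0 i)
            · exact SchwartzMap.le_seminorm ℝ _ _ φ x
  have hlim : Filter.Tendsto (fun k => a k * M) Filter.atTop (nhds 0) := by
    have h := (tendsto_one_div_add_atTop_nhds_zero_nat (𝕜 := ℝ)).mul_const M
    simpa [ha] using h
  filter_upwards [hlim.eventually_lt_const hε] with k hk
  exact (key k).trans_lt hk

theorem temperedDistribution_ext {u v : 𝓢'(Rn n, ℂ)}
    (h : ∀ φ : 𝓢(Rn n, ℂ), HasCompactSupport φ → u φ = v φ) (φ : 𝓢(Rn n, ℂ)) : u φ = v φ := by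
  obtain ⟨ψ, hψ, hlim⟩ := exists_tendsto_hasCompactSupport φ
  have h1 := ((map_continuous u).tendsto φ).comp hlim
  have h2 := ((map_continuous v).tendsto φ).comp hlim
  refine tendsto_nhds_unique h1 (h2.congr fun k => ?_)
  exact (h _ (hψ k)).symm

/-- The factor `|x-y|^(sp)` in `|difference s F|^p` reduces the kernel `|x-y|^(-(n+sp))` to the
density `|x-y|^(-n)`. -/
theorem gagliardo_eq_normLpOd (hn : 0 < n) {s p : ℝ} (hp : 1 ≤ p) {F : Rn n × Rn n → ℂ}
    (hF : MemLpOd p F) {w : Rn n → ℂ} (hw : LocallyIntegrable w)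
    (h : ∀ᵐ z : Rn n × Rn n, w z.1 - w z.2 = difference s F z) :
    gagliardo s p w ^ (1 / p) = normLpOd p F := by
  have hp0 : 0 < p := by linarith
  rw [normLpOd, eLpNorm_eq_lintegral_rpow_enorm_toReal (by simpa using hp0) (by simp),
    ENNReal.toReal_ofReal hp0.le, offDiagMeasure,
    lintegral_withDensity_eq_lintegral_mul₀ measurable_offDiagDensity.aemeasurable
      (hF.aestronglyMeasurable.enorm.pow_const p)]
  congr 1
  have hm : AEMeasurable fun z : Rn n × Rn n =>
      ‖w z.1 - w z.2‖ₑ ^ p * ENNReal.ofReal (‖z.1 - z.2‖ ^ (-(n + s * p))) := by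
    have h1 := ((locallyIntegrable_comp_fst hw).sub
      (locallyIntegrable_comp_snd hw)).aestronglyMeasurable.enorm
    exact (h1.pow_const p).mul (by fun_prop)
  simp only [gagliardo, gagliardoAt]
  rw [← lintegral_prod (f := fun z : Rn n × Rn n =>
      ‖w z.1 - w z.2‖ₑ ^ p * ENNReal.ofReal (‖z.1 - z.2‖ ^ (-(n + s * p))))
      (by rwa [← Measure.volume_eq_prod]), ← Measure.volume_eq_prod]
  refine lintegral_congr_ae ?_
  filter_upwards [h, ae_fst_ne_snd hn] with z hz hne
  have hpos : 0 < ‖z.1 - z.2‖ := norm_pos_iff.2 (sub_ne_zero.2 hne)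
  rw [hz, difference, enorm_mul, ENNReal.mul_rpow_of_nonneg _ _ hp0.le, Pi.mul_apply]
  have e : ‖((‖z.1 - z.2‖ ^ s : ℝ) : ℂ)‖ₑ = ENNReal.ofReal (‖z.1 - z.2‖ ^ s) := by
    rw [← ofReal_norm, Complex.norm_real, Real.norm_of_nonneg (by positivity)]
  rw [e, ENNReal.ofReal_rpow_of_nonneg (by positivity) hp0.le, ← Real.rpow_mul hpos.le,
    mul_right_comm, ← ENNReal.ofReal_mul (by positivity), ← Real.rpow_add hpos,
    show s * p + -(n + s * p) = -(n : ℝ) by ring, Real.rpow_neg hpos.le, Real.rpow_natCast]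

/-- With `w` real, the imaginary part of `w - c` is the constant `-Im c`. A constant in `L^q` of a
space of infinite measure is zero. -/
theorem im_eq_zero_of_memLp (hn : 0 < n) {q : ℝ} (hq : 0 < q) {w : Rn n → ℂ} {c : ℂ}
    (hw : ∀ᵐ x, (w x).im = 0) (hg : MemLp (fun x => w x - c) (ENNReal.ofReal q) volume) :
    c.im = 0 := by
  have : Nonempty (Fin n) := ⟨⟨0, hn⟩⟩
  have : NoncompactSpace (Rn n) := NormedSpace.noncompactSpace ℝ _
  have h1 : MemLp (fun _ : Rn n => -c.im) (ENNReal.ofReal q) volume := by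
    refine hg.im.ae_eq ?_
    filter_upwards [hw] with x hx
    simp [hx]
  rcases (memLp_const_iff (by simpa using hq) (by simp)).1 h1 with h | h
  · simpa using h
  · rw [measure_univ_of_isAddLeftInvariant] at h
    exact absurd h (lt_irrefl _)

end FracGrad

end

/-! ### The main theorem -/

theorem theorem4p4 (n : ℕ) (s p q : ℝ) (hs0 : 0 < s) (hs1 : s < 1) (hp : 1 ≤ p)
    (hsp : s * p < n) (hq : 1 / q = 1 / p - s / n) :
    ∃ K : ℝ, 0 < K ∧
      ∀ (u : 𝓢'(FracGrad.Rn n, ℂ)) (F : FracGrad.Rn n × FracGrad.Rn n → ℂ),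
        FracGrad.MemLpOd p F → FracGrad.IsGivenBy (FracGrad.fracGrad s u) F →
        ∃ (C : ℂ) (g : FracGrad.Rn n → ℂ),
          MemLp g (ENNReal.ofReal q) volume ∧
          (∀ φ : 𝓢(FracGrad.Rn n, ℂ),
            (u - FracGrad.constDistribution C : 𝓢'(FracGrad.Rn n, ℂ)) φ = ∫ x, g x * φ x) ∧
          eLpNorm g (ENNReal.ofReal q) volume ≤
            ENNReal.ofReal K * FracGrad.normLpOd p F ∧
          (FracGrad.IsRealDistribution u → C.im = 0) := by
  have hp0 : 0 < p := by linarith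
  have hn0 : (0 : ℝ) < n := (mul_pos hs0 hp0).trans hsp
  have hn : 0 < n := by exact_mod_cast hn0
  have hq0 : 0 < q := by
    rw [← one_div_pos, hq, sub_pos, div_lt_div_iff₀ hn0 hp0]
    linarith
  have hq1 : 1 ≤ q := by
    have h1 : 1 / p ≤ 1 := (div_le_one hp0).2 hp
    have h2 : 0 < s / n := by positivity
    have : 1 / q ≤ 1 := by linarith
    rwa [div_le_one hq0] at this
  obtain ⟨K, hK, hsob⟩ := FracGrad.exists_eLpNorm_sub_const_le hn hs0 hp hq1 hq
  refine ⟨K, hK, fun u F hF hu => ?_⟩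
  obtain ⟨w, hw, huw⟩ := FracGrad.exists_locallyIntegrable hn hs0 hp hF hu
  have hgag := FracGrad.gagliardo_eq_normLpOd hn hp hF hw
    (FracGrad.ae_difference_eq hn hs0 hp hF hu hw huw)
  have hfin : FracGrad.gagliardo s p w ≠ ⊤ := by
    intro h
    have := hF.norm_lt_top
    rw [← hgag, h, ENNReal.top_rpow_of_pos (by positivity)] at this
    exact lt_irrefl _ this
  obtain ⟨c, hc⟩ := hsob w hw hfin
  rw [hgag] at hc
  have hmem : MemLp (fun x => w x - c) (ENNReal.ofReal q) volume :=
    ⟨hw.aestronglyMeasurable.sub aestronglyMeasurable_const,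
      hc.trans_lt (ENNReal.mul_lt_top ENNReal.ofReal_lt_top hF.norm_lt_top)⟩
  refine ⟨c, fun x => w x - c, hmem, ?_, hc, fun hur =>
    FracGrad.im_eq_zero_of_memLp hn hq0 (FracGrad.ae_im_eq_zero hur hw huw) hmem⟩
  have : Fact (1 ≤ ENNReal.ofReal q) := ⟨by simpa using hq1⟩
  have hT (φ : 𝓢(FracGrad.Rn n, ℂ)) :
      Lp.toTemperedDistribution (hmem.toLp _) φ = ∫ x, (w x - c) * φ x := by
    rw [Lp.toTemperedDistribution_apply]
    refine integral_congr_ae ?_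
    filter_upwards [hmem.coeFn_toLp] with x hx
    rw [hx, smul_eq_mul, mul_comm]
  intro φ
  rw [← hT]
  -- So far `w` represents `u` only on compactly supported functions. Since `w - c` is in `L^q`, it
  -- defines a tempered distribution, and density extends the identity to all Schwartz functions.
  refine FracGrad.temperedDistribution_ext (fun ψ hψ => ?_) φ
  have hi : Integrable fun x => w x * ψ x := by
    simpa using hw.integrable_smul_right_of_hasCompactSupport ψ.continuous hψ
  have e : (u - FracGrad.constDistribution c : 𝓢'(FracGrad.Rn n, ℂ)) ψ =
      u ψ - c * ∫ x, ψ x := by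
    change u ψ - c • (volume : Measure (FracGrad.Rn n)).toTemperedDistribution ψ = _
    rw [Measure.toTemperedDistribution_apply volume, smul_eq_mul]
  rw [hT, e, huw ψ hψ, ← integral_const_mul, ← integral_sub hi (ψ.integrable.const_mul _)]
  simp only [sub_mul]
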